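/- Let $\lambda>0$ be a real number and let $\Omega$ be an alphabet with $b\ge 2$ symbols. For words $v,w$ let $|v|_w$ be the number of (possibly overlapping) occurrences of $w$ in $v$. A sequence $x\in\Omega^{\mathbb N}$ is $\lambda$-Poisson generic if for every integer $i\ge 0$ $$\lim_{k\to\infty}\frac{\#\{w\in\Omega^k:\ |x[1\ldots\lfloor\lambda b^k\rfloor+k-1]|_w=i\}}{b^k}=e^{-\lambda}\frac{\lambda^i}{i!},$$ and Borel normal if $\lim_{n\to\infty}|x[1\ldots n]|_w/n=b^{-|w|}$ for every word $w$. A cyclic de Bruijn word of order $n$ is a word of length $b^n$ in which, read circularly, every word of length $n$ occurs exactly once. An infinite de Bruijn sequence is a sequence $A\in\Omega^{\mathbb N}$ such that for every $k\ge1$ the word $A[1\ldots b^k]$ is a cyclic de Bruijn word of order $k$ if $b\ge 3$, and $A[1\ldots 2^{2k-1}]$ is a cyclic de Bruijn word of order $2k-1$ if $b=2$. Call a sequence $p=(p_i)_{i\ge0}$ of non-negative reals admissible if $\sum_i p_i=1$, $\sum_i i\,p_i=\lambda$, and $p_0\ge 1/2$ in case $b=2$. Construction. Given an infinite de Bruijn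 sequence $A$ and an admissible $p$, let $q_i^{1}=p_i$ and $q_i^{k}=\frac{b-1}{b}p_i$ for $k\ge2$, and let $a^k_{i,j}$ be the $j$-th digit of the base-$b$ expansion of $q_i^k$ (the expansion not ending in digits $b-1$ only, except that $1=0.(b-1)(b-1)\ldots$). At step $k=1,2,\ldots$ select, for all $i\ge1$ and $1\le j\le\lceil k/2\rceil$, exactly $a^k_{i,j}$ blocks (sets of consecutive positions) of length $b^{k-j}$ in $A[1\ldots b^k]$, all blocks selected in this and the earlier steps being non-overlapping; the blocks selected at step $1$, and if $b=2$ all blocks selected up to any given step, fill an initial segment of $A$ without gaps. Append to the output, for the blocks selected at this step in any order, the concatenation of $i$ copies of the block. The output is the limit $x\in\Omega^{\mathbb N}$ of the finite words so obtained. Then: 1. Every $\lambda$-Poisson generic sequence in $\Omega^{\mathbb N}$ is Borel normal. 2. There is a Borel normal sequence in $\Omega^{\mathbb N}$ that is not $\lambda$-Poisson generic. 3. Infinite de Bruijn sequences over $\Omega$ exist. For every infinite de Bruijn sequence $A$ and every admissible $p$ other than the Poisson distribution $(e^{-\lambda}\lambda^i/i!)_{i\ge0}$, the construction has an output, and each of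 its possible outputs is Borel normal and not $\lambda$-Poisson generic. For every infinite de Bruijn sequence $A$, the set of Borel normal sequences that are not $\lambda$-Poisson generic and are obtained in this way from some such $p$ is infinite. -/

import Mathlib

open Filter Topology

noncomputable section

namespace PoissonGen

/-! Infinite sequences over the alphabet `Ω` are functions `ℕ → Ω`, the symbol at position `n + 1`
of the mathematical text being the value at `n`. Words over `Ω` are lists. -/

section Words

variable {Ω : Type*}

/-- The word of length `len` that starts at index `start` of the sequence `x`. -/
def segment (x : ℕ → Ω) (start len : ℕ) : List Ω :=
  (List.range len).map fun t => x (start + t)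

/-- The initial segment `x[1...n]`. -/
def initial (x : ℕ → Ω) (n : ℕ) : List Ω := segment x 0 n

/-- The number of (possibly overlapping) occurrences of the word `w` in the word `v`. -/
def occ [DecidableEq Ω] (w v : List Ω) : ℕ :=
  ((Finset.range (v.length + 1 - w.length)).filter
    fun i => (v.drop i).take w.length = w).card

variable [Fintype Ω] [DecidableEq Ω]

/-- `Z lam i k x` is the proportion of words of length `k` that occur exactly `i` times in
`x[1...⌊lam b ^ k⌋ + k - 1]`, where `b` is the size of the alphabet (used for `k ≥ 1`). -/
def Z (lam : ℝ) (i k : ℕ) (x : ℕ → Ω) : ℝ :=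
  ((Finset.univ.filter fun w : Fin k → Ω =>
      occ (List.ofFn w)
        (initial x (⌊lam * (Fintype.card Ω : ℝ) ^ k⌋₊ + k - 1)) = i).card : ℝ)
    / (Fintype.card Ω : ℝ) ^ k

/-- The Poisson probability mass function of mean `lam`. -/
def poisson (lam : ℝ) (i : ℕ) : ℝ := Real.exp (-lam) * (lam ^ i / (Nat.factorial i : ℝ))

/-- `lam`-Poisson generic sequences. -/
def IsPoissonGeneric (lam : ℝ) (x : ℕ → Ω) : Prop :=
  ∀ i : ℕ, Tendsto (fun k : ℕ => Z lam i k x) atTop (𝓝 (poisson lam i))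

/-- Borel normal sequences. -/
def IsBorelNormal (x : ℕ → Ω) : Prop :=
  ∀ w : List Ω, Tendsto (fun n : ℕ => (occ w (initial x n) : ℝ) / (n : ℝ)) atTop
    (𝓝 (((Fintype.card Ω : ℝ) ^ w.length)⁻¹))

end Words

section DeBruijn

variable {Ω : Type*} [Fintype Ω]

/-- `w` is a cyclic de Bruijn word of order `n`: it has length `b ^ n`, and each word of length `n`
occurs exactly once in the circular word determined by `w`. -/
def IsCyclicDeBruijn (n : ℕ) (w : List Ω) : Prop :=
  w.length = Fintype.card Ω ^ n ∧
    ∀ v : List Ω, v.length = n → ∃! i : ℕ, i < w.length ∧ (w.rotate i).take n = v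

/-- Infinite de Bruijn sequences. With two symbols only the odd orders are required. -/
def IsInfiniteDeBruijn (A : ℕ → Ω) : Prop :=
  (3 ≤ Fintype.card Ω →
    ∀ k : ℕ, 1 ≤ k → IsCyclicDeBruijn k (initial A (Fintype.card Ω ^ k))) ∧
  (Fintype.card Ω = 2 →
    ∀ k : ℕ, 1 ≤ k → IsCyclicDeBruijn (2 * k - 1) (initial A (2 ^ (2 * k - 1))))

end DeBruijn

/-! ### The construction -/

section Construction

/-- The data from which the construction starts: a probability distribution on the non-negative
integers with mean `lam`, such that `p 0 ≥ 1 / 2` if the alphabet has `b = 2` symbols. -/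
structure IsAdmissible (b : ℕ) (lam : ℝ) (p : ℕ → ℝ) : Prop where
  nonneg : ∀ i, 0 ≤ p i
  hasSum_one : HasSum p 1
  hasSum_mean : HasSum (fun i : ℕ => (i : ℝ) * p i) lam
  half_le : b = 2 → 1 / 2 ≤ p 0

/-- The `j`-th digit after the point (`j ≥ 1`) of the base-`b` expansion of `y ∈ [0, 1]`: the
expansion that does not end in a tail of digits `b - 1` if `y < 1`, and `0.(b-1)(b-1)...` if
`y = 1`. -/
def digit (b : ℕ) (y : ℝ) (j : ℕ) : ℕ :=
  if y = 1 then b - 1 else ⌊y * (b : ℝ) ^ j⌋₊ % b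

/-- The number of digits used at step `k`, that is `⌈k / 2⌉`. -/
def numDigits (k : ℕ) : ℕ := (k + 1) / 2

/-- The real number whose first `numDigits k` digits are used at step `k` for the blocks that are
repeated `i` times: `p i` at the first step, `(b - 1) / b * p i` at every later one. -/
def target (b : ℕ) (p : ℕ → ℝ) (k i : ℕ) : ℝ :=
  if k = 1 then p i else ((b : ℝ) - 1) / (b : ℝ) * p i

/-- A block selected by the construction: the `len` indices from `start` on, whose content is to be
repeated `mult` times. -/
structure Block where
  start : ℕ
  len : ℕ
  mult : ℕ

/-- The index `n` belongs to the block `β`. -/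
def Block.Covers (β : Block) (n : ℕ) : Prop := β.start ≤ n ∧ n < β.start + β.len

/-- Two blocks do not overlap. -/
def Block.Disjoint (β γ : Block) : Prop := ∀ n : ℕ, ¬ (β.Covers n ∧ γ.Covers n)

/-- All blocks selected in the steps `1, ..., k`, where `S m` lists those of step `m`. -/
def selectedUpTo (S : ℕ → List Block) (k : ℕ) : List Block :=
  (List.range k).flatMap fun m => S (m + 1)

/-- The blocks of a list leave no gaps: they fill an initial segment of the indices. -/
def NoGaps (L : List Block) : Prop :=
  ∀ β ∈ L, ∀ n < β.start, ∃ γ ∈ L, γ.Covers n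

/-- `S 1, S 2, ...` is a selection of blocks that the construction may make from the distribution
`p` over an alphabet of `b` symbols, each `S k` in the order in which its blocks are used. -/
structure IsSelection (b : ℕ) (p : ℕ → ℝ) (S : ℕ → List Block) : Prop where
  /-- For `i ≥ 1` and `1 ≤ j ≤ numDigits k`, as many blocks of relative length `b ^ (-j)` with
  respect to the first `b ^ k` symbols are to be repeated `i` times as the `j`-th digit says. -/
  count_eq : ∀ k, 1 ≤ k → ∀ i, 1 ≤ i → ∀ j, 1 ≤ j → j ≤ numDigits k →
    (S k).countP (fun β => decide (β.mult = i ∧ β.len = b ^ (k - j)))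
      = digit b (target b p k i) j
  /-- No other blocks are selected. -/
  shape : ∀ k, 1 ≤ k → ∀ β ∈ S k,
    1 ≤ β.mult ∧ ∃ j, 1 ≤ j ∧ j ≤ numDigits k ∧ β.len = b ^ (k - j)
  /-- The blocks of step `k` lie in the initial segment of length `b ^ k`. -/
  fits : ∀ k, 1 ≤ k → ∀ β ∈ S k, β.start + β.len ≤ b ^ k
  /-- Selected blocks, of the same or of different steps, do not overlap. -/
  disjoint : ∀ k, (selectedUpTo S k).Pairwise Block.Disjoint
  /-- There are no gaps at the first step. -/
  noGaps_one : NoGaps (selectedUpTo S 1)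
  /-- With two symbols, there are never gaps. -/
  noGaps_two : b = 2 → ∀ k, NoGaps (selectedUpTo S k)

variable {Ω : Type*}

/-- The contribution of a block of `A` to the output: the concatenation of `mult` copies of it. -/
def runSegment (A : ℕ → Ω) (β : Block) : List Ω :=
  (List.replicate β.mult (segment A β.start β.len)).flatten

/-- The finite output after step `k`. -/
def outputUpTo (A : ℕ → Ω) (S : ℕ → List Block) (k : ℕ) : List Ω :=
  (selectedUpTo S k).flatMap (runSegment A)

/-- `x` is a possible output of the construction, run on the sequence `A` and the distribution `p`:
it is the limit of the finite outputs for some admitted selection of blocks. -/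
def IsOutput [Fintype Ω] (A : ℕ → Ω) (p : ℕ → ℝ) (x : ℕ → Ω) : Prop :=
  ∃ S : ℕ → List Block, IsSelection (Fintype.card Ω) p S ∧
    ∀ k : ℕ, outputUpTo A S k = initial x (outputUpTo A S k).length

end Construction

end PoissonGen

end

/-!
The key is that the output `x` of the construction run on `p` satisfies `Z lam i k x → p i` for
every `i` (`IsOutput.tendsto_Z`); so it is `lam`-Poisson generic only if `p` is the Poisson
distribution, and different `p` have different outputs. Conversely, any sequence whose proportions
converge to a distribution of mean `lam` is Borel normal (`isBorelNormal_of_tendsto_Z`), which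
covers both Poisson generic sequences and outputs.

*Normality.* The first `N = ⌊lam * b ^ k⌋` windows of length `k` have total mass `lam` per word. If
`Z lam i k x → p i` and `∑ i, i * p i = lam`, then words with many occurrences carry a negligible
part of these windows, so every set of `o(b ^ k)` words does. By Chebyshev's inequality the words of
length `k` in which a fixed word `v` has the wrong frequency form such a set. Hence most windows of
length `k` show the right frequency, and so does every initial segment whose length is between
`lam * b ^ (k - 1)` and `lam * b ^ k`.

*The proportions.* After step `k` the blocks of multiplicity `i` have total length
`p i * b ^ k - o(b ^ k)` (`HasCounts.mass_bounds`), and they are so few that windows of `A` across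
their ends do not matter. They lie in a de Bruijn word of order at most `k`, so windows of length
`k` inside blocks have distinct contents; with two symbols this holds for even `k` because the
blocks fill an initial segment of length at most `(1 - p 0) * 2 ^ k ≤ 2 ^ (k - 1)`. So for `i ≥ 1`
about `p i * b ^ k` words occur exactly `i` times inside copies of blocks. As
`∑ i, i * p i = lam`, such occurrences account for almost all of the `N` windows, whence
`liminf Z lam i k x ≥ p i` for `i ≥ 1`; since the mean of the proportions is at most `lam`, they
converge to `p` (`tendsto_of_eventually_ge`).

*Existence.* Blocks can be placed one after another, as their total length is at most `b ^ k`. A de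
Bruijn word of order `m` is a closed trail in the de Bruijn graph whose edges are the words of length
`m + 1`, or `m + 2` if `b = 2`. The edges off the trail are connected, so the trail extends to an
Eulerian one (`exists_extension`): a permutation that continues each edge by a next one has its cycles
merged into one, by exchanging the continuations of edges with the same end (`exists_single_cycle`).
-/

namespace PoissonGen

/-! ### Words and windows -/

section Basic

variable {Ω : Type*}

@[simp]
lemma length_segment (x : ℕ → Ω) (s n : ℕ) : (segment x s n).length = n := by
  simp [segment]

@[simp]
lemma length_initial (x : ℕ → Ω) (n : ℕ) : (initial x n).length = n := length_segment x 0 n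

lemma getElem_segment (x : ℕ → Ω) (s n i : ℕ) (h : i < (segment x s n).length) :
    (segment x s n)[i] = x (s + i) := by
  simp [segment]

lemma drop_take_segment (x : ℕ → Ω) {s n r m : ℕ} (h : r + m ≤ n) :
    ((segment x s n).drop r).take m = segment x (s + r) m := by
  apply List.ext_getElem
  · simp only [List.length_take, List.length_drop, length_segment]; omega
  · intro i h1 h2
    simp only [List.getElem_take, List.getElem_drop, getElem_segment, add_assoc]

/-- The word of length `k` that starts at index `t` of `x`, as a function on `Fin k`. -/
def win (x : ℕ → Ω) (k t : ℕ) : Fin k → Ω := fun i => x (t + i)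

lemma ofFn_win (x : ℕ → Ω) (k t : ℕ) : List.ofFn (win x k t) = segment x t k := by
  apply List.ext_getElem
  · simp
  · intro i h1 h2
    simp [win, getElem_segment]

lemma segment_eq_ofFn_iff (x : ℕ → Ω) {k : ℕ} (t : ℕ) (w : Fin k → Ω) :
    segment x t k = List.ofFn w ↔ win x k t = w := by
  rw [← ofFn_win, List.ofFn_inj]

variable [DecidableEq Ω]

lemma occ_segment (w : List Ω) (x : ℕ → Ω) (s n : ℕ) :
    occ w (segment x s n) =
      ((Finset.range (n + 1 - w.length)).filter fun r => segment x (s + r) w.length = w).card := by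
  unfold occ
  rw [length_segment]
  congr 1
  apply Finset.filter_congr
  intro r hr
  rw [Finset.mem_range] at hr
  rw [drop_take_segment x (by omega)]

lemma occ_ofFn_segment {k : ℕ} (w : Fin k → Ω) (x : ℕ → Ω) (s n : ℕ) :
    occ (List.ofFn w) (segment x s n) =
      ((Finset.range (n + 1 - k)).filter fun r => win x k (s + r) = w).card := by
  rw [occ_segment]
  simp only [List.length_ofFn, segment_eq_ofFn_iff]

lemma occ_append_le {w : List Ω} (hw : w ≠ []) (l₁ l₂ : List Ω) :
    occ w l₁ + occ w l₂ ≤ occ w (l₁ ++ l₂) := by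
  have hpos : 0 < w.length := List.length_pos_iff.mpr hw
  unfold occ
  rw [← Finset.card_map (addLeftEmbedding l₁.length) (s := (Finset.range _).filter
    fun i => (l₂.drop i).take w.length = w), ← Finset.card_union_of_disjoint]
  · apply Finset.card_le_card
    intro i hi
    simp only [Finset.mem_union, Finset.mem_map, Finset.mem_filter, Finset.mem_range,
      addLeftEmbedding_apply, List.length_append] at hi ⊢
    rcases hi with ⟨h1, h2⟩ | ⟨j, ⟨h1, h2⟩, rfl⟩
    · refine ⟨by omega, ?_⟩
      rw [List.drop_append_of_le_length (by omega), List.take_append_of_le_length, h2]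
      rw [List.length_drop]; omega
    · refine ⟨by omega, ?_⟩
      rw [List.drop_length_add_append, h2]
  · rw [Finset.disjoint_left]
    intro i hi hi'
    simp only [Finset.mem_map, Finset.mem_filter, Finset.mem_range,
      addLeftEmbedding_apply] at hi hi'
    obtain ⟨j, -, rfl⟩ := hi'
    omega

lemma mul_occ_le_occ_flatten_replicate {w : List Ω} (hw : w ≠ []) (m : ℕ) (l : List Ω) :
    m * occ w l ≤ occ w (List.replicate m l).flatten := by
  induction m with
  | zero => simp
  | succ m ih =>
    rw [List.replicate_succ, List.flatten_cons]
    have := occ_append_le hw l (List.replicate m l).flatten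
    rw [add_mul]; omega

/-- The number of the first `n` windows of length `k` of `x` that equal `w`. -/
def hits (x : ℕ → Ω) (k n : ℕ) (w : Fin k → Ω) : ℕ :=
  ((Finset.range n).filter fun t => win x k t = w).card

lemma hits_mono (x : ℕ → Ω) (k : ℕ) {m n : ℕ} (h : m ≤ n) (w : Fin k → Ω) :
    hits x k m w ≤ hits x k n w :=
  Finset.card_le_card (Finset.filter_subset_filter _ (Finset.range_mono h))

lemma occ_ofFn_initial {k : ℕ} (w : Fin k → Ω) (x : ℕ → Ω) (n : ℕ) :
    occ (List.ofFn w) (initial x n) = hits x k (n + 1 - k) w := by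
  rw [initial, occ_ofFn_segment, hits]
  simp only [zero_add]

lemma sum_mem_hits (x : ℕ → Ω) (k n : ℕ) (B : Finset (Fin k → Ω)) :
    ∑ w ∈ B, hits x k n w = ((Finset.range n).filter fun t => win x k t ∈ B).card := by
  unfold hits
  rw [Finset.card_eq_sum_card_fiberwise (f := fun t => win x k t) (t := B)]
  · refine Finset.sum_congr rfl fun w hw => ?_
    congr 1
    ext t
    simp only [Finset.mem_filter, and_assoc]
    constructor
    · rintro ⟨h, rfl⟩; exact ⟨h, hw, rfl⟩
    · rintro ⟨h, -, h'⟩; exact ⟨h, h'⟩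
  · intro t ht
    simpa using (Finset.mem_filter.mp ht).2

variable [Fintype Ω]

lemma sum_hits (x : ℕ → Ω) (k n : ℕ) : ∑ w, hits x k n w = n := by
  unfold hits
  rw [← Finset.card_eq_sum_card_fiberwise (fun _ _ => Finset.mem_coe.mpr (Finset.mem_univ _)),
    Finset.card_range]

lemma Z_eq (lam : ℝ) (i : ℕ) {k : ℕ} (hk : 1 ≤ k) (x : ℕ → Ω) :
    Z lam i k x = ((Finset.univ.filter fun w : Fin k → Ω =>
      hits x k ⌊lam * (Fintype.card Ω : ℝ) ^ k⌋₊ w = i).card : ℝ) /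
        (Fintype.card Ω : ℝ) ^ k := by
  unfold Z
  simp only [occ_ofFn_initial]
  rw [show ⌊lam * (Fintype.card Ω : ℝ) ^ k⌋₊ + k - 1 + 1 - k
    = ⌊lam * (Fintype.card Ω : ℝ) ^ k⌋₊ by omega]

/-- The words that occur at most `I` times account for `∑ i ≤ I, i * Z i` of the windows. -/
lemma sum_small_hits (x : ℕ → Ω) (k n I : ℕ) :
    ∑ i ∈ Finset.range (I + 1), i * (Finset.univ.filter fun w : Fin k → Ω => hits x k n w = i).card
      = ∑ w with hits x k n w ≤ I, hits x k n w := by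
  rw [← Finset.sum_fiberwise_of_maps_to (s := Finset.univ.filter fun w => hits x k n w ≤ I)
    (t := Finset.range (I + 1)) (g := fun w => hits x k n w)
    (fun w hw => by simpa [Nat.lt_succ_iff] using hw)]
  refine Finset.sum_congr rfl fun i hi => ?_
  rw [Finset.mem_range] at hi
  rw [Finset.filter_filter, Finset.sum_congr rfl (g := fun _ => i)
    (fun w hw => (Finset.mem_filter.mp hw).2.2), Finset.sum_const, smul_eq_mul, mul_comm]
  congr 2
  ext w
  simp only [Finset.mem_filter, Finset.mem_univ, true_and]
  omega

end Basic

/-! ### A weak law of large numbers for words -/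

section Normality

variable {Ω : Type*} [Fintype Ω] [DecidableEq Ω]

/-- The words with prescribed letters at the indices in `T` are `b ^ (k - |T|)` in number. -/
lemma card_agree_mul (k : ℕ) (T : Finset ℕ) (hT : T ⊆ Finset.range k) (v : ℕ → Ω) :
    (Finset.univ.filter fun w : Fin k → Ω => ∀ n : Fin k, (n : ℕ) ∈ T → w n = v n).card *
      Fintype.card Ω ^ T.card = Fintype.card Ω ^ k := by
  have h1 : (Finset.univ.filter fun w : Fin k → Ω => ∀ n : Fin k, (n : ℕ) ∈ T → w n = v n)
      = Fintype.piFinset fun n : Fin k => if (n : ℕ) ∈ T then {v n} else Finset.univ := by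
    ext w
    simp only [Finset.mem_filter, Finset.mem_univ, true_and, Fintype.mem_piFinset]
    refine forall_congr' fun n => ?_
    split_ifs with h <;> simp [h]
  have h2 : ∀ n : Fin k, (if (n : ℕ) ∈ T then {v n} else (Finset.univ : Finset Ω)).card
      = (fun n : ℕ => if n ∈ T then 1 else Fintype.card Ω) n := by
    intro n
    simp only
    split_ifs <;> simp
  rw [h1, Fintype.card_piFinset, Finset.prod_congr rfl (fun n _ => h2 n),
    Fin.prod_univ_eq_prod_range (fun n : ℕ => if n ∈ T then 1 else Fintype.card Ω)]
  have h3 : Fintype.card Ω ^ T.card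
      = ∏ n ∈ Finset.range k, if n ∈ T then Fintype.card Ω else 1 := by
    rw [Finset.prod_ite_mem, Finset.inter_eq_right.mpr hT, Finset.prod_const]
  rw [h3, ← Finset.prod_mul_distrib]
  conv_rhs => rw [← Finset.card_range k, ← Finset.prod_const]
  refine Finset.prod_congr rfl fun n _ => ?_
  split_ifs <;> simp

/-- The word formed by the first `l` symbols of `u` occurs in `w` at index `i`. -/
def OccursAt (u : ℕ → Ω) (l : ℕ) {k : ℕ} (w : Fin k → Ω) (i : ℕ) : Prop :=
  ∀ n : Fin k, i ≤ (n : ℕ) → (n : ℕ) < i + l → w n = u (n - i)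

instance (u : ℕ → Ω) (l : ℕ) {k : ℕ} (w : Fin k → Ω) : DecidablePred (OccursAt u l w) :=
  fun i => inferInstanceAs (Decidable (∀ n : Fin k, i ≤ (n : ℕ) → (n : ℕ) < i + l → w n = u (n - i)))

lemma card_occursAt_mul (u : ℕ → Ω) {l k i : ℕ} (h : i + l ≤ k) :
    (Finset.univ.filter fun w : Fin k → Ω => OccursAt u l w i).card * Fintype.card Ω ^ l
      = Fintype.card Ω ^ k := by
  have := card_agree_mul k (Finset.Ico i (i + l))
    (fun n hn => by simp only [Finset.mem_Ico] at hn; simp only [Finset.mem_range]; omega)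
    (fun n => u (n - i))
  rw [Nat.card_Ico, Nat.add_sub_cancel_left] at this
  rw [← this]
  congr 2
  refine Finset.filter_congr fun w _ => ?_
  simp only [OccursAt, Finset.mem_Ico, and_imp]

lemma card_occursAt_and_mul (u : ℕ → Ω) {l k i j : ℕ} (hij : i + l ≤ j) (h : j + l ≤ k) :
    (Finset.univ.filter fun w : Fin k → Ω => OccursAt u l w i ∧ OccursAt u l w j).card *
      Fintype.card Ω ^ (l + l) = Fintype.card Ω ^ k := by
  have hd : Disjoint (Finset.Ico i (i + l)) (Finset.Ico j (j + l)) := by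
    rw [Finset.disjoint_left]
    intro n hn hn'
    simp only [Finset.mem_Ico] at hn hn'
    omega
  have := card_agree_mul k (Finset.Ico i (i + l) ∪ Finset.Ico j (j + l))
    (fun n hn => by
      simp only [Finset.mem_Ico, Finset.mem_union] at hn; simp only [Finset.mem_range]; omega)
    (fun n => if n < i + l then u (n - i) else u (n - j))
  rw [Finset.card_union_of_disjoint hd, Nat.card_Ico, Nat.card_Ico, Nat.add_sub_cancel_left,
    Nat.add_sub_cancel_left] at this
  rw [← this]
  congr 2
  refine Finset.filter_congr fun w _ => ?_
  simp only [OccursAt, Finset.mem_union, Finset.mem_Ico]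
  constructor
  · rintro ⟨h1, h2⟩ n hn
    split_ifs with hc
    · exact h1 n (by omega) hc
    · exact h2 n (by omega) (by omega)
  · intro h1
    refine ⟨fun n hn hn' => ?_, fun n hn hn' => ?_⟩
    · have := h1 n (by omega); rwa [if_pos hn'] at this
    · have := h1 n (by omega); rwa [if_neg (by omega)] at this

/-- The centred indicator of the event that the first `l` symbols of `u` occur in `w` at `i`. -/
noncomputable def dev (u : ℕ → Ω) (l : ℕ) {k : ℕ} (i : ℕ) (w : Fin k → Ω) : ℝ :=
  (if OccursAt u l w i then 1 else 0) - ((Fintype.card Ω : ℝ) ^ l)⁻¹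

lemma abs_dev_le (hΩ : 0 < Fintype.card Ω) (u : ℕ → Ω) (l : ℕ) {k : ℕ} (i : ℕ)
    (w : Fin k → Ω) : |dev u l i w| ≤ 1 := by
  have h1 : (1 : ℝ) ≤ (Fintype.card Ω : ℝ) ^ l := one_le_pow₀ (by exact_mod_cast hΩ)
  have h2 : ((Fintype.card Ω : ℝ) ^ l)⁻¹ ≤ 1 := inv_le_one_of_one_le₀ h1
  have h3 : 0 ≤ ((Fintype.card Ω : ℝ) ^ l)⁻¹ := by positivity
  unfold dev
  rw [abs_le]
  split_ifs <;> constructor <;> linarith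

/-- Occurrences at indices that are at least `l` apart are uncorrelated. -/
lemma sum_dev_mul_dev (hΩ : 0 < Fintype.card Ω) (u : ℕ → Ω) {l k i j : ℕ} (hij : i + l ≤ j)
    (h : j + l ≤ k) : ∑ w : Fin k → Ω, dev u l i w * dev u l j w = 0 := by
  have hb : ((Fintype.card Ω : ℝ) ^ l) ≠ 0 := by positivity
  set β := ((Fintype.card Ω : ℝ) ^ l)⁻¹ with hβ
  have e : ∀ w : Fin k → Ω, dev u l i w * dev u l j w =
      (if OccursAt u l w i ∧ OccursAt u l w j then 1 else 0)
        - β * (if OccursAt u l w i then 1 else 0) - β * (if OccursAt u l w j then 1 else 0)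
        + β ^ 2 := by
    intro w
    unfold dev
    rw [← hβ]
    by_cases h1 : OccursAt u l w i <;> by_cases h2 : OccursAt u l w j <;> simp [h1, h2] <;> ring
  have c1 : ((Finset.univ.filter fun w : Fin k → Ω => OccursAt u l w i).card : ℝ)
      = (Fintype.card Ω : ℝ) ^ k * β := by
    rw [hβ, eq_mul_inv_iff_mul_eq₀ hb]
    exact_mod_cast card_occursAt_mul u (l := l) (k := k) (i := i) (by omega)
  have c2 : ((Finset.univ.filter fun w : Fin k → Ω => OccursAt u l w j).card : ℝ)
      = (Fintype.card Ω : ℝ) ^ k * β := by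
    rw [hβ, eq_mul_inv_iff_mul_eq₀ hb]
    exact_mod_cast card_occursAt_mul u (l := l) (k := k) (i := j) (by omega)
  have c3 : ((Finset.univ.filter fun w : Fin k → Ω =>
      OccursAt u l w i ∧ OccursAt u l w j).card : ℝ) = (Fintype.card Ω : ℝ) ^ k * β ^ 2 := by
    rw [hβ, inv_pow, eq_mul_inv_iff_mul_eq₀ (by positivity), ← pow_mul, mul_two]
    exact_mod_cast card_occursAt_and_mul u hij h
  rw [Finset.sum_congr rfl (fun w _ => e w), Finset.sum_add_distrib, Finset.sum_sub_distrib,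
    Finset.sum_sub_distrib, ← Finset.mul_sum, ← Finset.mul_sum, Finset.sum_boole,
    Finset.sum_boole, Finset.sum_boole, c1, c2, c3]
  simp only [Finset.sum_const, Finset.card_univ, Fintype.card_pi, Finset.prod_const,
    Fintype.card_fin, nsmul_eq_mul, Nat.cast_pow]
  ring

/-- The second moment of the number of occurrences grows linearly, as only pairs of indices at
distance less than `l` are correlated. -/
lemma sum_sq_dev_le (hΩ : 0 < Fintype.card Ω) (u : ℕ → Ω) {l k : ℕ} :
    ∑ w : Fin k → Ω, (∑ i ∈ Finset.range (k + 1 - l), dev u l i w) ^ 2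
      ≤ (k + 1 - l : ℕ) * (2 * l) * (Fintype.card Ω : ℝ) ^ k := by
  set M := k + 1 - l with hM
  have hbd : ∀ i j, ∑ w : Fin k → Ω, dev u l i w * dev u l j w ≤ (Fintype.card Ω : ℝ) ^ k := by
    intro i j
    calc ∑ w : Fin k → Ω, dev u l i w * dev u l j w ≤ ∑ w : Fin k → Ω, (1 : ℝ) := by
          refine Finset.sum_le_sum fun w _ => (le_abs_self _).trans ?_
          rw [abs_mul]
          exact mul_le_one₀ (abs_dev_le hΩ u l i w) (abs_nonneg _) (abs_dev_le hΩ u l j w)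
      _ = (Fintype.card Ω : ℝ) ^ k := by simp
  calc ∑ w : Fin k → Ω, (∑ i ∈ Finset.range M, dev u l i w) ^ 2
      = ∑ i ∈ Finset.range M, ∑ j ∈ Finset.range M, ∑ w : Fin k → Ω,
          dev u l i w * dev u l j w := by
        simp only [sq, Finset.sum_mul_sum]
        rw [Finset.sum_comm]
        exact Finset.sum_congr rfl fun i _ => Finset.sum_comm
    _ ≤ ∑ i ∈ Finset.range M, (2 * l) * (Fintype.card Ω : ℝ) ^ k := by
        refine Finset.sum_le_sum fun i hi => ?_
        rw [Finset.mem_range] at hi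
        have hsub : ∑ j ∈ Finset.range M, ∑ w : Fin k → Ω, dev u l i w * dev u l j w
            = ∑ j ∈ (Finset.range M).filter (fun j => i < j + l ∧ j < i + l),
                ∑ w : Fin k → Ω, dev u l i w * dev u l j w := by
          symm
          apply Finset.sum_subset (Finset.filter_subset _ _)
          intro j hj hj'
          rw [Finset.mem_range] at hj
          simp only [Finset.mem_filter, Finset.mem_range, not_and, not_lt] at hj'
          by_cases hc : i < j + l
          · exact sum_dev_mul_dev hΩ u (hj' hj hc) (by omega)
          · simp only [mul_comm (dev u l i _)]
            exact sum_dev_mul_dev hΩ u (not_lt.mp hc) (by omega)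
        rw [hsub]
        refine (Finset.sum_le_card_nsmul _ _ _ fun j _ => hbd i j).trans ?_
        rw [nsmul_eq_mul]
        refine mul_le_mul_of_nonneg_right ?_ (by positivity)
        have : ((Finset.range M).filter (fun j => i < j + l ∧ j < i + l)).card ≤ 2 * l := by
          have hs : (Finset.range M).filter (fun j => i < j + l ∧ j < i + l)
              ⊆ Finset.Ico (i + 1 - l) (i + l) := by
            intro j hj
            simp only [Finset.mem_filter, Finset.mem_range, Finset.mem_Ico] at hj ⊢
            omega
          have := Finset.card_le_card hs
          rw [Nat.card_Ico] at this
          omega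
        exact_mod_cast this
    _ = M * (2 * l) * (Fintype.card Ω : ℝ) ^ k := by
        rw [Finset.sum_const, Finset.card_range, nsmul_eq_mul, ← mul_assoc]

/-- The words of length `k` in which the frequency of the first `l` symbols of `u` deviates by more
than `ε` from its mean. -/
noncomputable def badWords (u : ℕ → Ω) (l : ℕ) (ε : ℝ) (k : ℕ) : Finset (Fin k → Ω) :=
  Finset.univ.filter fun w => ε * (k + 1 - l : ℕ) < |∑ i ∈ Finset.range (k + 1 - l), dev u l i w|

/-- The weak law of large numbers, from the second moment by Chebyshev's inequality. -/
lemma card_badWords_le (hΩ : 0 < Fintype.card Ω) (u : ℕ → Ω) {l k : ℕ} (hlk : l ≤ k) {ε : ℝ}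
    (hε : 0 < ε) :
    ((badWords u l ε k).card : ℝ) ≤
      2 * l / ε ^ 2 * ((k + 1 - l : ℕ) : ℝ)⁻¹ * (Fintype.card Ω : ℝ) ^ k := by
  have hM : (0 : ℝ) < (k + 1 - l : ℕ) := by
    have : 0 < k + 1 - l := by omega
    exact_mod_cast this
  have hs := sum_sq_dev_le hΩ u (l := l) (k := k)
  set M : ℕ := k + 1 - l with hMdef
  have h1 : ((badWords u l ε k).card : ℝ) * (ε * M) ^ 2
      ≤ ∑ w : Fin k → Ω, (∑ i ∈ Finset.range M, dev u l i w) ^ 2 := by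
    rw [← nsmul_eq_mul, ← Finset.sum_const]
    refine (Finset.sum_le_sum fun w hw => ?_).trans
      (Finset.sum_le_sum_of_subset_of_nonneg (Finset.subset_univ (badWords u l ε k))
        fun w _ _ => sq_nonneg _)
    have hw' := (Finset.mem_filter.mp hw).2
    rw [← sq_abs (∑ i ∈ Finset.range M, dev u l i w)]
    exact pow_le_pow_left₀ (by positivity) hw'.le 2
  have h2 := h1.trans hs
  have h3 : 0 < (ε * M) ^ 2 := by positivity
  rw [← le_div_iff₀ h3] at h2
  refine h2.trans (le_of_eq ?_)
  field_simp

lemma tendsto_card_badWords (hΩ : 0 < Fintype.card Ω) (u : ℕ → Ω) (l : ℕ) {ε : ℝ}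
    (hε : 0 < ε) :
    Tendsto (fun k => ((badWords u l ε k).card : ℝ) / (Fintype.card Ω : ℝ) ^ k) atTop (𝓝 0) := by
  have hlim : Tendsto (fun k : ℕ => 2 * l / ε ^ 2 * ((k + 1 - l : ℕ) : ℝ)⁻¹) atTop (𝓝 0) := by
    have h1 : Tendsto (fun k : ℕ => k + 1 - l) atTop atTop :=
      tendsto_atTop_mono (fun k => by omega) (tendsto_sub_atTop_nat l)
    have h2 : Tendsto (fun k : ℕ => ((k + 1 - l : ℕ) : ℝ)⁻¹) atTop (𝓝 0) :=
      tendsto_inv_atTop_zero.comp (tendsto_natCast_atTop_atTop.comp h1)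
    simpa using h2.const_mul (2 * l / ε ^ 2)
  refine squeeze_zero' (Eventually.of_forall fun k => by positivity) ?_ hlim
  filter_upwards [eventually_ge_atTop l] with k hk
  rw [div_le_iff₀ (by positivity)]
  exact card_badWords_le hΩ u hk hε

/-- Counting the pairs of a window of length `k` and an occurrence in it in two ways: if few of the
first `n` windows are bad, then the frequency among the first `n` indices is right. -/
lemma abs_count_sub_le (hΩ : 0 < Fintype.card Ω) (u : ℕ → Ω) {l k : ℕ} (hlk : l ≤ k) {ε : ℝ}
    (hε : 0 < ε) (x : ℕ → Ω) (n : ℕ) :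
    |(((Finset.range n).filter fun t => ∀ j < l, x (t + j) = u j).card : ℝ)
        - n * ((Fintype.card Ω : ℝ) ^ l)⁻¹| ≤
      k + ε * n + ((Finset.range n).filter fun t => win x k t ∈ badWords u l ε k).card := by
  set M : ℕ := k + 1 - l with hMdef
  have hM : (0 : ℝ) < M := by
    have : 0 < M := by omega
    exact_mod_cast this
  set β := ((Fintype.card Ω : ℝ) ^ l)⁻¹ with hβ
  let P : ℕ → Prop := fun t => ∀ j < l, x (t + j) = u j
  let X : ℕ → ℝ := fun t => (if P t then 1 else 0) - β
  have hX : ∀ t, |X t| ≤ 1 := by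
    intro t
    have h1 : (1 : ℝ) ≤ (Fintype.card Ω : ℝ) ^ l := one_le_pow₀ (by exact_mod_cast hΩ)
    have h2 : β ≤ 1 := inv_le_one_of_one_le₀ h1
    have h3 : 0 ≤ β := by positivity
    simp only [X]
    rw [abs_le]
    split_ifs <;> constructor <;> linarith
  have hcount : (((Finset.range n).filter fun t => ∀ j < l, x (t + j) = u j).card : ℝ) - n * β
      = ∑ t ∈ Finset.range n, X t := by
    simp only [X, P]
    rw [Finset.sum_sub_distrib, Finset.sum_boole, Finset.sum_const, Finset.card_range,
      nsmul_eq_mul]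
  rw [hcount]
  set S := ∑ t ∈ Finset.range n, X t with hS
  have hdev : ∀ t, ∀ i ∈ Finset.range M, dev u l i (win x k t) = X (t + i) := by
    intro t i hi
    rw [Finset.mem_range] at hi
    have hiff : OccursAt u l (win x k t) i ↔ P (t + i) := by
      simp only [OccursAt, win, P]
      constructor
      · intro h j hj
        have := h ⟨i + j, by omega⟩ (by simp) (by simpa using hj)
        simpa [add_assoc] using this
      · intro h m hm hm'
        have := h (m - i) (by omega)
        rwa [show t + i + ((m : ℕ) - i) = t + m by omega] at this
    simp only [dev, X, hiff, hβ]
  have hshift : ∀ i, |S - ∑ t ∈ Finset.range n, X (t + i)| ≤ 2 * i := by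
    intro i
    induction i with
    | zero => simp [hS]
    | succ i ih =>
      have h1 : ∑ t ∈ Finset.range n, X (t + i) - ∑ t ∈ Finset.range n, X (t + (i + 1))
          = X i - X (n + i) := by
        have := Finset.sum_range_sub' (fun t => X (t + i)) n
        rw [Finset.sum_sub_distrib] at this
        simp only [zero_add, add_right_comm _ 1 i] at this
        simpa only [← add_assoc] using this
      have h2 : S - ∑ t ∈ Finset.range n, X (t + (i + 1))
          = (S - ∑ t ∈ Finset.range n, X (t + i)) + (X i - X (n + i)) := by rw [← h1]; ring
      rw [h2]
      refine (abs_add_le _ _).trans ?_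
      have h3 := abs_sub (X i) (X (n + i))
      have h4 := hX i
      have h5 := hX (n + i)
      push_cast
      linarith
  have hwin : ∀ t, |∑ i ∈ Finset.range M, X (t + i)|
      ≤ ε * M + M * (if win x k t ∈ badWords u l ε k then 1 else 0) := by
    intro t
    rw [← Finset.sum_congr rfl (hdev t)]
    split_ifs with hb
    · have : |∑ i ∈ Finset.range M, dev u l i (win x k t)| ≤ M := by
        refine (Finset.abs_sum_le_sum_abs _ _).trans ?_
        refine (Finset.sum_le_card_nsmul _ _ 1 fun i _ => abs_dev_le hΩ u l i _).trans ?_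
        simp
      have h0 : 0 ≤ ε * M := by positivity
      linarith
    · simp only [badWords, Finset.mem_filter, Finset.mem_univ, true_and, not_lt] at hb
      simpa using hb
  have hsum : |∑ t ∈ Finset.range n, ∑ i ∈ Finset.range M, X (t + i)| ≤
      n * (ε * M) +
        M * ((Finset.range n).filter fun t => win x k t ∈ badWords u l ε k).card := by
    refine (Finset.abs_sum_le_sum_abs _ _).trans ((Finset.sum_le_sum fun t _ => hwin t).trans ?_)
    rw [Finset.sum_add_distrib, ← Finset.mul_sum _ _ (M : ℝ), Finset.sum_boole, Finset.sum_const,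
      Finset.card_range, nsmul_eq_mul]
  have hdiff : |∑ i ∈ Finset.range M, (S - ∑ t ∈ Finset.range n, X (t + i))| ≤ M * k := by
    refine (Finset.abs_sum_le_sum_abs _ _).trans ((Finset.sum_le_sum fun i _ => hshift i).trans ?_)
    rw [← Finset.mul_sum, ← Nat.cast_sum]
    have h1 := Finset.sum_range_id_mul_two M
    have h2 : (∑ i ∈ Finset.range M, i) * 2 ≤ M * k := by
      rw [h1]; exact Nat.mul_le_mul_left _ (by omega)
    have h3 : (((∑ i ∈ Finset.range M, i) * 2 : ℕ) : ℝ) ≤ ((M * k : ℕ) : ℝ) := by exact_mod_cast h2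
    push_cast at h3 ⊢
    linarith
  rw [Finset.sum_sub_distrib, Finset.sum_const, Finset.card_range, nsmul_eq_mul,
    Finset.sum_comm] at hdiff
  have hfin : M * |S| ≤ M * (k + ε * n +
      ((Finset.range n).filter fun t => win x k t ∈ badWords u l ε k).card) := by
    rw [← abs_of_pos hM, ← abs_mul, abs_of_pos hM]
    have h1 := abs_sub_abs_le_abs_sub (M * S)
      (∑ t ∈ Finset.range n, ∑ i ∈ Finset.range M, X (t + i))
    linarith
  exact le_of_mul_le_mul_left hfin hM

end Normality

/-! ### Borel normality from the limits of the proportions -/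

section NormalityOfLimits

variable {Ω : Type*} [Fintype Ω] [DecidableEq Ω]

/-- If the proportions `Z i` converge to a distribution of mean `lam`, no mass escapes to words with
many occurrences, so a set of words of small proportion carries a small part of the windows. -/
lemma eventually_card_bad_windows_le (hΩ : 2 ≤ Fintype.card Ω) {lam : ℝ} (hlam : 0 < lam)
    {p : ℕ → ℝ} (hp : HasSum (fun i : ℕ => (i : ℝ) * p i) lam) {x : ℕ → Ω}
    (hx : ∀ i, Tendsto (fun k => Z lam i k x) atTop (𝓝 (p i))) (B : ∀ k, Finset (Fin k → Ω))
    (hB : Tendsto (fun k => ((B k).card : ℝ) / (Fintype.card Ω : ℝ) ^ k) atTop (𝓝 0))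
    {δ : ℝ} (hδ : 0 < δ) :
    ∀ᶠ k in atTop, (((Finset.range ⌊lam * (Fintype.card Ω : ℝ) ^ k⌋₊).filter
      fun t => win x k t ∈ B k).card : ℝ) ≤ δ * (Fintype.card Ω : ℝ) ^ k := by
  set b : ℝ := (Fintype.card Ω : ℝ) with hb
  have hbpos : 0 < b := by
    rw [hb]
    exact_mod_cast (by omega : 0 < Fintype.card Ω)
  obtain ⟨I, hI⟩ : ∃ I : ℕ, lam - δ / 2 < ∑ i ∈ Finset.range (I + 1), (i : ℝ) * p i :=
    (((hp.tendsto_sum_nat.comp (tendsto_add_atTop_nat 1)).eventually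
      (lt_mem_nhds (show lam - δ / 2 < lam by linarith))).exists)
  have h1 : Tendsto (fun k => ∑ i ∈ Finset.range (I + 1), (i : ℝ) * Z lam i k x) atTop
      (𝓝 (∑ i ∈ Finset.range (I + 1), (i : ℝ) * p i)) :=
    tendsto_finsetSum _ fun i _ => (hx i).const_mul _
  have h2 : Tendsto (fun k => (I : ℝ) * (((B k).card : ℝ) / b ^ k)) atTop (𝓝 0) := by
    simpa using hB.const_mul (I : ℝ)
  filter_upwards [h1.eventually (lt_mem_nhds hI), h2.eventually (gt_mem_nhds (half_pos hδ)),
    eventually_ge_atTop 1] with k hk1 hk2 hk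
  set N := ⌊lam * b ^ k⌋₊ with hN
  have hbk : 0 < b ^ k := by positivity
  have hNle : (N : ℝ) ≤ lam * b ^ k := Nat.floor_le (by positivity)
  have hsmall : (∑ w with hits x k N w ≤ I, (hits x k N w : ℝ))
      = (∑ i ∈ Finset.range (I + 1), (i : ℝ) * Z lam i k x) * b ^ k := by
    rw [← Nat.cast_sum, ← sum_small_hits, Nat.cast_sum, Finset.sum_mul]
    refine Finset.sum_congr rfl fun i _ => ?_
    rw [Z_eq lam i hk, ← hb, ← hN, mul_assoc, div_mul_cancel₀ _ hbk.ne', Nat.cast_mul]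
  have htot : (∑ w with hits x k N w ≤ I, (hits x k N w : ℝ))
      + ∑ w with ¬ hits x k N w ≤ I, (hits x k N w : ℝ) = N := by
    rw [Finset.sum_filter_add_sum_filter_not, ← Nat.cast_sum, sum_hits]
  have hbad : (((Finset.range N).filter fun t => win x k t ∈ B k).card : ℝ)
      ≤ I * (B k).card + ∑ w with ¬ hits x k N w ≤ I, (hits x k N w : ℝ) := by
    rw [← sum_mem_hits, Nat.cast_sum, ← Finset.sum_filter_add_sum_filter_not (B k)
      (fun w => hits x k N w ≤ I)]
    refine add_le_add ?_ ?_
    · refine (Finset.sum_le_card_nsmul _ _ (I : ℝ) fun w hw => ?_).trans ?_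
      · exact_mod_cast (Finset.mem_filter.mp hw).2
      · rw [nsmul_eq_mul, mul_comm]
        exact mul_le_mul_of_nonneg_left
          (by exact_mod_cast Finset.card_le_card (Finset.filter_subset _ _)) (Nat.cast_nonneg _)
    · exact Finset.sum_le_sum_of_subset_of_nonneg
        (Finset.filter_subset_filter _ (Finset.subset_univ _)) fun _ _ _ => Nat.cast_nonneg _
  rw [← mul_div_assoc, div_lt_iff₀ hbk] at hk2
  have h3 := mul_lt_mul_of_pos_right hk1 hbk
  nlinarith

/-- A sequence for which the proportions `Z i` converge to a distribution of mean `lam` is Borel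
normal. -/
theorem isBorelNormal_of_tendsto_Z (hΩ : 2 ≤ Fintype.card Ω) {lam : ℝ} (hlam : 0 < lam)
    {p : ℕ → ℝ} (hp : HasSum (fun i : ℕ => (i : ℝ) * p i) lam) {x : ℕ → Ω}
    (hx : ∀ i, Tendsto (fun k => Z lam i k x) atTop (𝓝 (p i))) : IsBorelNormal x := by
  have hΩ' : 0 < Fintype.card Ω := by omega
  intro v
  set b : ℝ := (Fintype.card Ω : ℝ) with hb
  have hb2 : 2 ≤ b := by rw [hb]; exact_mod_cast hΩ
  have hbpos : 0 < b := by linarith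
  set l := v.length with hl
  obtain ⟨u, hu⟩ : ∃ u : ℕ → Ω, v = segment u 0 l := by
    have : Nonempty Ω := Fintype.card_pos_iff.mp hΩ'
    refine ⟨fun n => v.getD n (Classical.arbitrary Ω), ?_⟩
    apply List.ext_getElem
    · simp [hl]
    · intro i h1 h2
      simp [getElem_segment, h1]
  -- the number of occurrences among the first `n` indices, without regard to the end of the word
  set c : ℕ → ℕ := fun n => ((Finset.range n).filter fun t => ∀ j < l, x (t + j) = u j).card
    with hc
  have hmatch : ∀ t, segment x t l = v ↔ ∀ j < l, x (t + j) = u j := by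
    intro t
    rw [hu]
    constructor
    · intro h j hj
      have := congrArg (fun s : List Ω => s[j]?) h
      simpa [segment, hj] using this
    · intro h
      apply List.ext_getElem
      · simp
      · intro i h1 h2
        simpa [getElem_segment] using h i (by simpa using h1)
  have hocc : ∀ n, |(occ v (initial x n) : ℝ) - c n| ≤ l + 1 := by
    intro n
    have h1 : occ v (initial x n) = c (n + 1 - l) := by
      rw [initial, occ_segment, hc]
      simp only [zero_add, ← hl, hmatch]
    have hstep : ∀ m d, c (m + d) ≤ c m + d ∧ c m ≤ c (m + d) := by
      intro m d
      refine ⟨?_, Finset.card_le_card (Finset.filter_subset_filter _ (Finset.range_mono (by omega)))⟩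
      have hsub : (Finset.range (m + d)).filter (fun t => ∀ j < l, x (t + j) = u j) ⊆
          (Finset.range m).filter (fun t => ∀ j < l, x (t + j) = u j) ∪ Finset.Ico m (m + d) := by
        intro t ht
        simp only [Finset.mem_filter, Finset.mem_range, Finset.mem_union, Finset.mem_Ico] at ht ⊢
        by_cases h : t < m
        · exact Or.inl ⟨h, ht.2⟩
        · exact Or.inr ⟨by omega, ht.1⟩
      have h2 := (Finset.card_le_card hsub).trans (Finset.card_union_le _ _)
      rw [Nat.card_Ico, Nat.add_sub_cancel_left] at h2
      exact h2
    rw [h1]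
    have h3 : c (n + 1 - l) ≤ c n + 1 ∧ c n ≤ c (n + 1 - l) + l := by
      rcases Nat.eq_zero_or_pos l with h0 | h0
      · rw [h0]
        have := hstep n 1
        simp only [Nat.sub_zero]
        omega
      · have h4 := hstep (n + 1 - l) (n - (n + 1 - l))
        rw [show n + 1 - l + (n - (n + 1 - l)) = n by omega] at h4
        omega
    have h4 : (c (n + 1 - l) : ℝ) ≤ c n + 1 := by exact_mod_cast h3.1
    have h5 : (c n : ℝ) ≤ c (n + 1 - l) + l := by exact_mod_cast h3.2
    have h6 : (0 : ℝ) ≤ l := Nat.cast_nonneg _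
    rw [abs_le]
    constructor <;> linarith
  rw [Metric.tendsto_atTop]
  intro ε hε
  -- each of the four error terms will be at most `ε / 5` of `n`
  set δ := ε * lam / (5 * b) with hδ
  have hδpos : 0 < δ := by positivity
  have hbad := eventually_card_bad_windows_le hΩ hlam hp hx (badWords u l (ε / 5))
    (tendsto_card_badWords hΩ' u l (by positivity)) hδpos
  have hk_small : ∀ᶠ k : ℕ in atTop, (k : ℝ) ≤ δ * b ^ k := by
    have h1 : Tendsto (fun k : ℕ => (k : ℝ) / b ^ k) atTop (𝓝 0) := by
      simpa using tendsto_pow_const_div_const_pow_of_one_lt 1 (show 1 < b by linarith)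
    filter_upwards [h1.eventually (gt_mem_nhds hδpos)] with k hk
    rw [div_lt_iff₀ (by positivity)] at hk
    exact hk.le
  obtain ⟨K, hK⟩ := eventually_atTop.mp (hbad.and (hk_small.and (eventually_ge_atTop l)))
  have hNtop : Tendsto (fun k : ℕ => ⌊lam * b ^ k⌋₊) atTop atTop :=
    tendsto_nat_floor_atTop.comp
      ((tendsto_pow_atTop_atTop_of_one_lt (by linarith)).const_mul_atTop hlam)
  have hNmono : Monotone fun k : ℕ => ⌊lam * b ^ k⌋₊ := by
    intro m n hmn
    exact Nat.floor_mono (mul_le_mul_of_nonneg_left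
      (pow_le_pow_right₀ (by linarith) hmn) hlam.le)
  obtain ⟨n₁, hn₁⟩ := exists_nat_gt ((l + 1 : ℝ) * 5 / ε)
  refine ⟨max (⌊lam * b ^ K⌋₊ + 1) (n₁ + 1), fun n hn => ?_⟩
  have hnK : ⌊lam * b ^ K⌋₊ < n := by have := le_max_left (⌊lam * b ^ K⌋₊ + 1) (n₁ + 1); omega
  have hnn₁ : n₁ < n := by have := le_max_right (⌊lam * b ^ K⌋₊ + 1) (n₁ + 1); omega
  have hnpos : (0 : ℝ) < n := by exact_mod_cast (by omega : 0 < n)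
  have hex : ∃ k, n ≤ ⌊lam * b ^ k⌋₊ := (hNtop.eventually (eventually_ge_atTop n)).exists
  set k := Nat.find hex with hk
  have hkn : n ≤ ⌊lam * b ^ k⌋₊ := Nat.find_spec hex
  have hKk : K < k := by
    by_contra hcon
    exact absurd (hkn.trans (hNmono (not_lt.mp hcon))) (by simpa using hnK)
  have hprev : lam * b ^ (k - 1) < n := by
    have := Nat.find_min hex (m := k - 1) (by omega)
    exact (Nat.floor_lt (by positivity)).mp (not_le.mp this)
  have hbk : δ * b ^ k ≤ ε / 5 * n := by
    have h1 : b ^ k = b ^ (k - 1) * b := by rw [← pow_succ]; congr 1; omega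
    have h2 : δ * b ^ k = ε / 5 * (lam * b ^ (k - 1)) := by
      rw [hδ, h1]; field_simp
    rw [h2]
    exact mul_le_mul_of_nonneg_left hprev.le (by positivity)
  obtain ⟨hK1, hK2, hK3⟩ := hK k hKk.le
  have hmain := abs_count_sub_le hΩ' u hK3 (show 0 < ε / 5 by positivity) x n
  have hmono : (((Finset.range n).filter fun t => win x k t ∈ badWords u l (ε / 5) k).card : ℝ)
      ≤ ((Finset.range ⌊lam * b ^ k⌋₊).filter
          fun t => win x k t ∈ badWords u l (ε / 5) k).card := by
    exact_mod_cast Finset.card_le_card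
      (Finset.filter_subset_filter _ (Finset.range_mono hkn))
  have hend : (l + 1 : ℝ) < ε / 5 * n := by
    have h1 : (l + 1 : ℝ) * 5 / ε < n := hn₁.trans (by exact_mod_cast hnn₁)
    rw [div_lt_iff₀ hε] at h1
    linarith
  have htot : |(occ v (initial x n) : ℝ) - n * (b ^ l)⁻¹| < ε * n := by
    have h1 := abs_sub_le (occ v (initial x n) : ℝ) (c n) (n * (b ^ l)⁻¹)
    have h2 := hocc n
    simp only [hc] at h1 h2
    linarith
  rw [Real.dist_eq, show (occ v (initial x n) : ℝ) / n - (b ^ l)⁻¹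
    = (occ v (initial x n) - n * (b ^ l)⁻¹) / n by field_simp, abs_div, abs_of_pos hnpos,
    div_lt_iff₀ hnpos]
  exact htot

end NormalityOfLimits

/-! ### The total length of the selected blocks -/

section Masses

lemma digit_le (b : ℕ) (hb : 1 ≤ b) (y : ℝ) (j : ℕ) : digit b y j ≤ b := by
  unfold digit
  split_ifs
  · omega
  · exact (Nat.mod_lt _ (by omega)).le

/-- The first `n` digits, read as an integer. -/
lemma sum_digit_of_lt_one {b : ℕ} (hb : 1 ≤ b) {y : ℝ} (hy1 : y < 1) (n : ℕ) :
    ∑ j ∈ Finset.range n, digit b y (j + 1) * b ^ (n - (j + 1)) = ⌊y * (b : ℝ) ^ n⌋₊ := by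
  induction n with
  | zero =>
    simp only [Finset.range_zero, Finset.sum_empty, pow_zero, mul_one]
    exact (Nat.floor_eq_zero.mpr hy1).symm
  | succ n ih =>
    have h1 : ∑ j ∈ Finset.range n, digit b y (j + 1) * b ^ (n + 1 - (j + 1))
        = b * ∑ j ∈ Finset.range n, digit b y (j + 1) * b ^ (n - (j + 1)) := by
      rw [Finset.mul_sum]
      refine Finset.sum_congr rfl fun j hj => ?_
      rw [Finset.mem_range] at hj
      rw [show n + 1 - (j + 1) = n - (j + 1) + 1 by omega, pow_succ]
      ring
    have h2 : ⌊y * (b : ℝ) ^ n⌋₊ = ⌊y * (b : ℝ) ^ (n + 1)⌋₊ / b := by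
      rw [← Nat.floor_div_natCast, pow_succ, ← mul_assoc, mul_div_assoc, div_self (by positivity),
        mul_one]
    rw [Finset.sum_range_succ, h1, ih, h2, digit, if_neg hy1.ne, Nat.sub_self, pow_zero, mul_one]
    exact Nat.div_add_mod _ _

lemma sum_digit_one {b : ℕ} (hb : 1 ≤ b) (n : ℕ) :
    ∑ j ∈ Finset.range n, digit b 1 (j + 1) * b ^ (n - (j + 1)) + 1 = b ^ n := by
  simp only [digit, if_true]
  rw [← Finset.mul_sum, Finset.sum_congr rfl (g := fun j => b ^ (n - 1 - j))
    (fun j _ => by rw [Nat.sub_sub, Nat.add_comm 1 j]), Finset.sum_range_reflect (fun j => b ^ j) n]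
  obtain ⟨c, rfl⟩ : ∃ c, b = c + 1 := ⟨b - 1, by omega⟩
  rw [Nat.add_sub_cancel, mul_comm]
  exact geom_sum_mul_add c n

/-- Truncation after `J ≤ k` digits changes `y * b ^ k` by at most `b ^ (k - J)`. -/
lemma sum_digit_bounds {b : ℕ} (hb : 1 ≤ b) {y : ℝ} (hy0 : 0 ≤ y) (hy1 : y ≤ 1) {J k : ℕ}
    (hJ : J ≤ k) :
    ((∑ j ∈ Finset.range J, digit b y (j + 1) * b ^ (k - (j + 1)) : ℕ) : ℝ) ≤ y * (b : ℝ) ^ k ∧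
    y * (b : ℝ) ^ k ≤ ((∑ j ∈ Finset.range J, digit b y (j + 1) * b ^ (k - (j + 1)) : ℕ) : ℝ)
      + (b : ℝ) ^ (k - J) := by
  have hscale : ∑ j ∈ Finset.range J, digit b y (j + 1) * b ^ (k - (j + 1))
      = (∑ j ∈ Finset.range J, digit b y (j + 1) * b ^ (J - (j + 1))) * b ^ (k - J) := by
    rw [Finset.sum_mul]
    refine Finset.sum_congr rfl fun j hj => ?_
    rw [Finset.mem_range] at hj
    rw [mul_assoc, ← pow_add]
    congr 2
    omega
  have hpow : (b : ℝ) ^ k = (b : ℝ) ^ J * (b : ℝ) ^ (k - J) := by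
    rw [← pow_add]; congr 1; omega
  have hbd : ((∑ j ∈ Finset.range J, digit b y (j + 1) * b ^ (J - (j + 1)) : ℕ) : ℝ)
        ≤ y * (b : ℝ) ^ J ∧
      y * (b : ℝ) ^ J ≤
        ((∑ j ∈ Finset.range J, digit b y (j + 1) * b ^ (J - (j + 1)) : ℕ) : ℝ) + 1 := by
    rcases hy1.lt_or_eq with h | rfl
    · rw [sum_digit_of_lt_one hb h]
      exact ⟨Nat.floor_le (by positivity), (Nat.lt_floor_add_one _).le⟩
    · have h := sum_digit_one hb J
      have h' : ((∑ j ∈ Finset.range J, digit b 1 (j + 1) * b ^ (J - (j + 1)) : ℕ) : ℝ) + 1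
          = (b : ℝ) ^ J := by exact_mod_cast h
      constructor <;> linarith
  have hpos : (0 : ℝ) ≤ (b : ℝ) ^ (k - J) := by positivity
  rw [hscale, Nat.cast_mul, Nat.cast_pow, hpow, ← mul_assoc]
  constructor
  · exact mul_le_mul_of_nonneg_right hbd.1 hpos
  · have := mul_le_mul_of_nonneg_right hbd.2 hpos
    linarith

lemma IsAdmissible.le_one {b : ℕ} {lam : ℝ} {p : ℕ → ℝ} (hp : IsAdmissible b lam p) (i : ℕ) :
    p i ≤ 1 :=
  le_hasSum hp.hasSum_one i fun j _ => hp.nonneg j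

lemma IsAdmissible.target_mem {b : ℕ} (hb : 1 ≤ b) {lam : ℝ} {p : ℕ → ℝ}
    (hp : IsAdmissible b lam p) (k i : ℕ) : 0 ≤ target b p k i ∧ target b p k i ≤ 1 := by
  have hb' : (1 : ℝ) ≤ b := by exact_mod_cast hb
  have h0 := hp.nonneg i
  have h1 := hp.le_one i
  unfold target
  split_ifs
  · exact ⟨h0, h1⟩
  · have h2 : 0 ≤ ((b : ℝ) - 1) / b := div_nonneg (by linarith) (by linarith)
    have h3 : ((b : ℝ) - 1) / b ≤ 1 := (div_le_one (by linarith)).mpr (by linarith)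
    exact ⟨mul_nonneg h2 h0, mul_le_one₀ h3 h0 h1⟩

/-- The first two requirements on a selection, which fix the number and the sizes of its blocks. -/
structure HasCounts (b : ℕ) (p : ℕ → ℝ) (S : ℕ → List Block) : Prop where
  count_eq : ∀ k, 1 ≤ k → ∀ i, 1 ≤ i → ∀ j, 1 ≤ j → j ≤ numDigits k →
    (S k).countP (fun β => decide (β.mult = i ∧ β.len = b ^ (k - j)))
      = digit b (target b p k i) j
  shape : ∀ k, 1 ≤ k → ∀ β ∈ S k,
    1 ≤ β.mult ∧ ∃ j, 1 ≤ j ∧ j ≤ numDigits k ∧ β.len = b ^ (k - j)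

lemma IsSelection.hasCounts {b : ℕ} {p : ℕ → ℝ} {S : ℕ → List Block} (h : IsSelection b p S) :
    HasCounts b p S := ⟨h.count_eq, h.shape⟩

/-- The blocks of `L` that are to be repeated `i` times. -/
def ofMult (L : List Block) (i : ℕ) : List Block := L.filter fun β => decide (β.mult = i)

lemma ofMult_append (L L' : List Block) (i : ℕ) :
    ofMult (L ++ L') i = ofMult L i ++ ofMult L' i := List.filter_append ..

/-- If the lengths of the blocks are among the distinct numbers `e 0, ..., e (J - 1)`, then a sum
over the blocks of multiplicity `i` can be taken length by length. -/
lemma sum_map_ofMult_eq {L : List Block} {J : ℕ} {e : ℕ → ℕ}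
    (he : Set.InjOn e (Finset.range J)) (hL : ∀ β ∈ L, ∃ j < J, β.len = e j) (i : ℕ)
    (f : ℕ → ℕ) :
    ((ofMult L i).map fun β => f β.len).sum = ∑ j ∈ Finset.range J,
      L.countP (fun β => decide (β.mult = i ∧ β.len = e j)) * f (e j) := by
  induction L with
  | nil => simp [ofMult]
  | cons β L ih =>
    have ih' := ih fun γ hγ => hL γ (List.mem_cons_of_mem _ hγ)
    obtain ⟨j₀, hj₀, hlen⟩ := hL β List.mem_cons_self
    have hsplit : ∑ j ∈ Finset.range J,
        (β :: L).countP (fun β => decide (β.mult = i ∧ β.len = e j)) * f (e j)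
        = ∑ j ∈ Finset.range J, L.countP (fun β => decide (β.mult = i ∧ β.len = e j)) * f (e j)
          + ∑ j ∈ Finset.range J, if β.mult = i ∧ β.len = e j then f (e j) else 0 := by
      rw [← Finset.sum_add_distrib]
      refine Finset.sum_congr rfl fun j _ => ?_
      rw [List.countP_cons]
      by_cases h : β.mult = i ∧ β.len = e j <;> simp [h, add_mul]
    rw [hsplit, ← ih']
    by_cases hm : β.mult = i
    · have : ∑ j ∈ Finset.range J, (if β.mult = i ∧ β.len = e j then f (e j) else 0)
          = f β.len := by
        rw [Finset.sum_eq_single j₀]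
        · rw [if_pos ⟨hm, hlen⟩, hlen]
        · intro j hj hne
          refine if_neg fun h => hne ?_
          exact he hj (Finset.mem_coe.mpr (Finset.mem_range.mpr hj₀)) (h.2.symm.trans hlen)
        · intro h; exact absurd (Finset.mem_range.mpr hj₀) h
      rw [this]
      simp [ofMult, hm, add_comm]
    · simp [ofMult, hm]

lemma numDigits_le {k : ℕ} (hk : 1 ≤ k) : numDigits k ≤ k := by
  unfold numDigits; omega

lemma HasCounts.sum_map_ofMult {b : ℕ} (hb : 2 ≤ b) {p : ℕ → ℝ} {S : ℕ → List Block}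
    (hS : HasCounts b p S) {k i : ℕ} (hk : 1 ≤ k) (hi : 1 ≤ i) (f : ℕ → ℕ) :
    ((ofMult (S k) i).map fun β => f β.len).sum = ∑ j ∈ Finset.range (numDigits k),
      digit b (target b p k i) (j + 1) * f (b ^ (k - (j + 1))) := by
  have hnk := numDigits_le hk
  rw [sum_map_ofMult_eq (J := numDigits k) (e := fun j => b ^ (k - (j + 1)))]
  · refine Finset.sum_congr rfl fun j hj => ?_
    rw [Finset.mem_range] at hj
    rw [hS.count_eq k hk i hi (j + 1) (by omega) (by omega)]
  · intro j hj j' hj' h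
    simp only [Finset.coe_range, Set.mem_Iio] at hj hj'
    have := Nat.pow_right_injective hb h
    omega
  · intro β hβ
    obtain ⟨-, j, hj1, hj2, hj3⟩ := hS.shape k hk β hβ
    exact ⟨j - 1, by omega, by rw [hj3]; congr 2; omega⟩

lemma selectedUpTo_succ (S : ℕ → List Block) (k : ℕ) :
    selectedUpTo S (k + 1) = selectedUpTo S k ++ S (k + 1) := by
  simp [selectedUpTo, List.range_succ, List.flatMap_append]

lemma selectedUpTo_zero (S : ℕ → List Block) : selectedUpTo S 0 = [] := by
  simp [selectedUpTo]

lemma mem_selectedUpTo {S : ℕ → List Block} {k : ℕ} {β : Block} :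
    β ∈ selectedUpTo S k ↔ ∃ m, 1 ≤ m ∧ m ≤ k ∧ β ∈ S m := by
  simp only [selectedUpTo, List.mem_flatMap, List.mem_range]
  constructor
  · rintro ⟨m, hm, h⟩; exact ⟨m + 1, by omega, by omega, h⟩
  · rintro ⟨m, h1, h2, h⟩
    exact ⟨m - 1, by omega, by rwa [Nat.sub_add_cancel h1]⟩

/-- The total length of the blocks of `L` that are to be repeated `i` times. -/
def mass (L : List Block) (i : ℕ) : ℕ := ((ofMult L i).map Block.len).sum

/-- The total length of the blocks of multiplicity `i` is `p i * b ^ k`, up to rounding: the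
lengths `q i * b ^ m` for `m ≤ k` telescope. -/
lemma HasCounts.mass_bounds {b : ℕ} (hb : 2 ≤ b) {lam : ℝ} {p : ℕ → ℝ}
    (hp : IsAdmissible b lam p) {S : ℕ → List Block} (hS : HasCounts b p S) {k i : ℕ}
    (hk : 1 ≤ k) (hi : 1 ≤ i) :
    (mass (selectedUpTo S k) i : ℝ) ≤ p i * (b : ℝ) ^ k ∧
      p i * (b : ℝ) ^ k ≤ mass (selectedUpTo S k) i + k * (b : ℝ) ^ (k / 2) := by
  have hb1 : (1 : ℝ) ≤ b := by exact_mod_cast (by omega : 1 ≤ b)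
  have hstep : ∀ m, 1 ≤ m → (mass (S m) i : ℝ) ≤ target b p m i * (b : ℝ) ^ m ∧
      target b p m i * (b : ℝ) ^ m ≤ mass (S m) i + (b : ℝ) ^ (m / 2) := by
    intro m hm
    obtain ⟨h0, h1⟩ := hp.target_mem (by omega : 1 ≤ b) m i
    have h := sum_digit_bounds (by omega : 1 ≤ b) h0 h1 (numDigits_le hm)
    rw [show m - numDigits m = m / 2 by unfold numDigits; omega] at h
    have hmass : mass (S m) i = ∑ j ∈ Finset.range (numDigits m),
        digit b (target b p m i) (j + 1) * b ^ (m - (j + 1)) :=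
      hS.sum_map_ofMult hb hm hi fun n => n
    rw [hmass]
    exact h
  have happ : ∀ m, mass (selectedUpTo S (m + 1)) i
      = mass (selectedUpTo S m) i + mass (S (m + 1)) i := by
    intro m
    rw [selectedUpTo_succ, mass, ofMult_append, List.map_append, List.sum_append]
    rfl
  induction k, hk using Nat.le_induction with
  | base =>
    have h := hstep 1 le_rfl
    rw [target, if_pos rfl] at h
    rw [happ 0, selectedUpTo_zero]
    simp only [mass, ofMult, List.filter_nil, List.map_nil, List.sum_nil, zero_add,
      Nat.cast_one, one_mul] at h ⊢
    exact h
  | succ m hm ih =>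
    have h := hstep (m + 1) (by omega)
    rw [target, if_neg (by omega)] at h
    have htel : p i * (b : ℝ) ^ m + ((b : ℝ) - 1) / b * p i * (b : ℝ) ^ (m + 1)
        = p i * (b : ℝ) ^ (m + 1) := by
      have : (b : ℝ) ≠ 0 := by positivity
      field_simp
      ring
    have hmono : (b : ℝ) ^ (m / 2) ≤ (b : ℝ) ^ ((m + 1) / 2) :=
      pow_le_pow_right₀ hb1 (by omega)
    have hmm : (m : ℝ) * (b : ℝ) ^ (m / 2) ≤ m * (b : ℝ) ^ ((m + 1) / 2) :=
      mul_le_mul_of_nonneg_left hmono (Nat.cast_nonneg _)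
    rw [happ m]
    push_cast
    constructor <;> linarith [ih.1, ih.2, h.1, h.2]

/-- For a fixed multiplicity, the number of blocks grows only quadratically. -/
lemma HasCounts.length_ofMult_le {b : ℕ} (hb : 2 ≤ b) {p : ℕ → ℝ} {S : ℕ → List Block}
    (hS : HasCounts b p S) (k : ℕ) {i : ℕ} (hi : 1 ≤ i) :
    (ofMult (selectedUpTo S k) i).length ≤ k * (k * b) := by
  induction k with
  | zero => simp [selectedUpTo_zero, ofMult]
  | succ k ih =>
    have h1 := hS.sum_map_ofMult hb (k := k + 1) (by omega) hi fun _ => 1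
    simp only [List.map_const', List.sum_replicate, smul_eq_mul, mul_one] at h1
    have h2 : ∑ j ∈ Finset.range (numDigits (k + 1)),
        digit b (target b p (k + 1) i) (j + 1) ≤ (k + 1) * b := by
      refine (Finset.sum_le_card_nsmul _ _ b fun j _ => digit_le b (by omega) _ _).trans ?_
      rw [Finset.card_range, smul_eq_mul]
      exact Nat.mul_le_mul_right _ (numDigits_le (by omega))
    rw [selectedUpTo_succ, ofMult_append, List.length_append, h1]
    have h3 : k * (k * b) ≤ k * ((k + 1) * b) :=
      Nat.mul_le_mul_left _ (Nat.mul_le_mul_right _ (by omega))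
    calc _ ≤ k * ((k + 1) * b) + (k + 1) * b := by omega
      _ = (k + 1) * ((k + 1) * b) := by ring

/-- A sum over blocks can be taken multiplicity by multiplicity. -/
lemma sum_map_eq_sum_ofMult (L : List Block) (G : Block → ℕ) {M : ℕ}
    (hM : ∀ β ∈ L, β.mult < M) :
    (L.map G).sum = ∑ i ∈ Finset.range M, ((ofMult L i).map G).sum := by
  induction L with
  | nil => simp [ofMult]
  | cons β L ih =>
    have hβ := hM β List.mem_cons_self
    rw [List.map_cons, List.sum_cons, ih fun γ hγ => hM γ (List.mem_cons_of_mem _ hγ)]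
    have : ∀ i, ((ofMult (β :: L) i).map G).sum
        = (if β.mult = i then G β else 0) + ((ofMult L i).map G).sum := by
      intro i
      by_cases h : β.mult = i <;> simp [ofMult, h]
    simp only [this, Finset.sum_add_distrib, Finset.sum_ite_eq, Finset.mem_range, hβ, if_true]

lemma exists_mult_lt (L : List Block) : ∃ M, ∀ β ∈ L, β.mult < M := by
  induction L with
  | nil => exact ⟨0, by simp⟩
  | cons β L ih =>
    obtain ⟨M, hM⟩ := ih
    refine ⟨max M (β.mult + 1), fun γ hγ => ?_⟩
    rcases List.mem_cons.mp hγ with rfl | h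
    · omega
    · have := hM γ h; omega

lemma sum_map_mult_mul (L : List Block) (i : ℕ) (f : Block → ℕ) :
    ((ofMult L i).map fun β => β.mult * f β).sum = i * ((ofMult L i).map f).sum := by
  rw [← List.sum_map_mul_left]
  congr 1
  refine List.map_congr_left fun β hβ => ?_
  rw [of_decide_eq_true (List.mem_filter.mp hβ).2]

/-- The finite output of step `k` has length at most `lam * b ^ k`. -/
lemma HasCounts.sum_mult_mul_len_le {b : ℕ} (hb : 2 ≤ b) {lam : ℝ} {p : ℕ → ℝ}
    (hp : IsAdmissible b lam p) {S : ℕ → List Block} (hS : HasCounts b p S) {k : ℕ}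
    (hk : 1 ≤ k) :
    ((((selectedUpTo S k).map fun β => β.mult * β.len).sum : ℕ) : ℝ) ≤ lam * (b : ℝ) ^ k := by
  obtain ⟨M, hM⟩ := exists_mult_lt (selectedUpTo S k)
  rw [sum_map_eq_sum_ofMult _ _ hM]
  simp only [sum_map_mult_mul]
  change ((∑ i ∈ Finset.range M, i * mass (selectedUpTo S k) i : ℕ) : ℝ) ≤ _
  have hle : ∑ i ∈ Finset.range M, (i : ℝ) * p i ≤ lam :=
    sum_le_hasSum _ (fun i _ => mul_nonneg (Nat.cast_nonneg _) (hp.nonneg i)) hp.hasSum_mean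
  calc ((∑ i ∈ Finset.range M, i * mass (selectedUpTo S k) i : ℕ) : ℝ)
      ≤ ∑ i ∈ Finset.range M, (i : ℝ) * p i * (b : ℝ) ^ k := by
        push_cast
        refine Finset.sum_le_sum fun i _ => ?_
        rcases Nat.eq_zero_or_pos i with rfl | hi
        · simp
        · rw [mul_assoc]
          exact mul_le_mul_of_nonneg_left (hS.mass_bounds hb hp hk hi).1 (Nat.cast_nonneg _)
    _ = (∑ i ∈ Finset.range M, (i : ℝ) * p i) * (b : ℝ) ^ k := by rw [Finset.sum_mul]
    _ ≤ lam * (b : ℝ) ^ k := mul_le_mul_of_nonneg_right hle (by positivity)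

/-- The blocks selected up to step `k` have total length at most `(1 - p 0) * b ^ k`. -/
lemma HasCounts.sum_len_le {b : ℕ} (hb : 2 ≤ b) {lam : ℝ} {p : ℕ → ℝ}
    (hp : IsAdmissible b lam p) {S : ℕ → List Block} (hS : HasCounts b p S) {k : ℕ}
    (hk : 1 ≤ k) :
    ((((selectedUpTo S k).map Block.len).sum : ℕ) : ℝ) ≤ (1 - p 0) * (b : ℝ) ^ k := by
  obtain ⟨M, hM⟩ := exists_mult_lt (selectedUpTo S k)
  have h0 : ofMult (selectedUpTo S k) 0 = [] := by
    rw [ofMult, List.filter_eq_nil_iff]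
    intro β hβ
    obtain ⟨m, hm1, -, hm⟩ := mem_selectedUpTo.mp hβ
    have := (hS.shape m hm1 β hm).1
    simp only [decide_eq_true_eq]
    omega
  rw [sum_map_eq_sum_ofMult _ _ (M := M + 1) (fun β hβ => (hM β hβ).trans (Nat.lt_succ_self M)),
    Finset.sum_range_succ', h0]
  have hle : ∑ i ∈ Finset.range M, p (i + 1) ≤ 1 - p 0 := by
    have := sum_le_hasSum (Finset.range (M + 1)) (fun i _ => hp.nonneg i) hp.hasSum_one
    rw [Finset.sum_range_succ'] at this
    linarith
  calc ((∑ i ∈ Finset.range M, mass (selectedUpTo S k) (i + 1) + 0 : ℕ) : ℝ)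
      ≤ ∑ i ∈ Finset.range M, p (i + 1) * (b : ℝ) ^ k := by
        push_cast
        rw [add_zero]
        exact Finset.sum_le_sum fun i _ => (hS.mass_bounds hb hp hk (by omega)).1
    _ = (∑ i ∈ Finset.range M, p (i + 1)) * (b : ℝ) ^ k := by rw [Finset.sum_mul]
    _ ≤ (1 - p 0) * (b : ℝ) ^ k := mul_le_mul_of_nonneg_right hle (by positivity)

end Masses

/-! ### Lower bounds on proportions with a given mean -/

section Squeeze

/-- Proportions `Y i` of total mass `1` and mean at most `lam` that are asymptotically at least
`p i` for `i ≥ 1`, where `p` is a distribution of mean `lam`, converge to `p`: the mean leaves no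
room for an excess. -/
lemma tendsto_of_eventually_ge {lam : ℝ} {p : ℕ → ℝ} (hone : HasSum p 1)
    (hmean : HasSum (fun i : ℕ => (i : ℝ) * p i) lam) {Y : ℕ → ℕ → ℝ}
    (h1 : ∀ᶠ k in atTop, ∀ I, ∑ i ∈ Finset.range I, Y i k ≤ 1)
    (h2 : ∀ᶠ k in atTop, ∀ I, ∑ i ∈ Finset.range I, (i : ℝ) * Y i k ≤ lam)
    (h3 : ∀ᶠ k in atTop, ∀ I, 1 + ∑ i ∈ Finset.range (I + 1), (i : ℝ) * Y i k
      ≤ lam + ∑ i ∈ Finset.range (I + 1), Y i k)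
    (hlow : ∀ i, 1 ≤ i → ∀ ε > 0, ∀ᶠ k in atTop, p i - ε ≤ Y i k) (i : ℕ) :
    Tendsto (Y i) atTop (𝓝 (p i)) := by
  have hpos : ∀ i, 1 ≤ i → Tendsto (Y i) atTop (𝓝 (p i)) := by
    intro i hi
    rw [Metric.tendsto_nhds]
    intro ε hε
    obtain ⟨I, hI, hiI⟩ : ∃ I : ℕ, lam - ε / 4 < ∑ j ∈ Finset.range I, (j : ℝ) * p j ∧ i < I :=
      ((hmean.tendsto_sum_nat.eventually (lt_mem_nhds (by linarith))).and
        (eventually_gt_atTop i)).exists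
    set T : ℝ := ∑ j ∈ Finset.range I, (j : ℝ) with hT
    have hT0 : 0 ≤ T := Finset.sum_nonneg fun _ _ => Nat.cast_nonneg _
    set η := ε / (4 * (T + 1)) with hη
    have hηpos : 0 < η := by positivity
    have hηT : η * T ≤ ε / 4 := by
      rw [hη, div_mul_eq_mul_div, div_le_div_iff₀ (by positivity) (by norm_num)]
      nlinarith
    have hall : ∀ᶠ k in atTop, ∀ j ∈ Finset.range I, 1 ≤ j → p j - η ≤ Y j k := by
      rw [Filter.eventually_all_finset]
      intro j _
      by_cases hj : 1 ≤ j
      · filter_upwards [hlow j hj η hηpos] with k hk _ using hk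
      · exact Eventually.of_forall fun k h => absurd h hj
    filter_upwards [hall, h2, hlow i hi (ε / 2) (by positivity)] with k hk hk2 hk3
    have hi' : (1 : ℝ) ≤ i := by exact_mod_cast hi
    have hmem : i ∈ Finset.range I := Finset.mem_range.mpr hiI
    have hrest : ∑ j ∈ (Finset.range I).erase i, (j : ℝ) * p j - η * T
        ≤ ∑ j ∈ (Finset.range I).erase i, (j : ℝ) * Y j k := by
      have hT' : ∑ j ∈ (Finset.range I).erase i, (j : ℝ) ≤ T :=
        Finset.sum_le_sum_of_subset_of_nonneg (Finset.erase_subset _ _)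
          fun _ _ _ => Nat.cast_nonneg _
      have : ∑ j ∈ (Finset.range I).erase i, ((j : ℝ) * p j - η * j)
          ≤ ∑ j ∈ (Finset.range I).erase i, (j : ℝ) * Y j k := by
        refine Finset.sum_le_sum fun j hj => ?_
        rcases Nat.eq_zero_or_pos j with rfl | hj0
        · simp
        · have := mul_le_mul_of_nonneg_left (hk j (Finset.mem_of_mem_erase hj) hj0)
            (Nat.cast_nonneg (α := ℝ) j)
          linarith
      rw [Finset.sum_sub_distrib, ← Finset.mul_sum] at this
      nlinarith
    have e1 := Finset.add_sum_erase (Finset.range I) (fun j => (j : ℝ) * p j) hmem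
    have e2 := Finset.add_sum_erase (Finset.range I) (fun j => (j : ℝ) * Y j k) hmem
    have h4 := hk2 I
    have hup : (i : ℝ) * (Y i k - p i) ≤ ε / 2 := by linarith
    have hup' : Y i k - p i ≤ ε / 2 := by
      by_contra hcon
      rw [not_le] at hcon
      nlinarith
    rw [Real.dist_eq, abs_lt]
    constructor <;> linarith
  rcases Nat.eq_zero_or_pos i with rfl | hi
  swap
  · exact hpos i hi
  have hsum1 : Tendsto (fun I => ∑ i ∈ Finset.range I, p (i + 1)) atTop (𝓝 (1 - p 0)) := by
    have := hone.tendsto_sum_nat.comp (tendsto_add_atTop_nat 1)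
    simp only [Function.comp_def, Finset.sum_range_succ'] at this
    simpa using this.sub_const (p 0)
  have hY : ∀ I, Tendsto (fun k => ∑ i ∈ Finset.range I, Y (i + 1) k) atTop
      (𝓝 (∑ i ∈ Finset.range I, p (i + 1))) := fun I =>
    tendsto_finsetSum _ fun i _ => hpos (i + 1) (by omega)
  have hYm : ∀ I, Tendsto (fun k => ∑ i ∈ Finset.range I, (i : ℝ) * Y i k) atTop
      (𝓝 (∑ i ∈ Finset.range I, (i : ℝ) * p i)) := by
    intro I
    refine tendsto_finsetSum _ fun i _ => ?_
    rcases Nat.eq_zero_or_pos i with rfl | hi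
    · simp
    · exact (hpos i hi).const_mul _
  rw [Metric.tendsto_nhds]
  intro ε hε
  obtain ⟨I, hI1, hI2⟩ : ∃ I : ℕ, |∑ i ∈ Finset.range I, p (i + 1) - (1 - p 0)| < ε / 4 ∧
      lam - ε / 4 < ∑ j ∈ Finset.range (I + 1), (j : ℝ) * p j :=
    ((Metric.tendsto_nhds.mp hsum1 (ε / 4) (by positivity)).and
      ((hmean.tendsto_sum_nat.comp (tendsto_add_atTop_nat 1)).eventually
        (lt_mem_nhds (show lam - ε / 4 < lam by linarith)))).exists
  filter_upwards [h1, h3, Metric.tendsto_nhds.mp (hY I) (ε / 4) (by positivity),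
    (hYm (I + 1)).eventually (lt_mem_nhds hI2)] with k hk1 hk3 hkY hkm
  have h4 := hk1 (I + 1)
  have h5 := hk3 I
  rw [Finset.sum_range_succ' (fun i => Y i k)] at h4 h5
  rw [Real.dist_eq] at hkY ⊢
  rw [abs_lt] at hI1 hkY ⊢
  constructor <;> linarith

end Squeeze

/-! ### Windows of the output inside copies of blocks -/

section WindowsOfOutput

variable {Ω : Type*}

/-- In the first `b ^ n` symbols, the word of length `n` at an index determines the index. -/
lemma IsCyclicDeBruijn.segment_inj [Fintype Ω] {A : ℕ → Ω} {n : ℕ} (hn : 1 ≤ n)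
    (h : IsCyclicDeBruijn n (initial A (Fintype.card Ω ^ n))) {t t' : ℕ}
    (ht : t + n ≤ Fintype.card Ω ^ n) (ht' : t' + n ≤ Fintype.card Ω ^ n)
    (heq : segment A t n = segment A t' n) : t = t' := by
  have hrot : ∀ s, s + n ≤ Fintype.card Ω ^ n →
      ((initial A (Fintype.card Ω ^ n)).rotate s).take n = segment A s n := by
    intro s hs
    rw [List.rotate_eq_drop_append_take (by rw [length_initial]; omega),
      List.take_append_of_le_length (by rw [List.length_drop, length_initial]; omega),
      initial, drop_take_segment A hs, zero_add]
  obtain ⟨i, -, hi⟩ := h.2 (segment A t n) (length_segment A t n)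
  rw [hi t ⟨by rw [length_initial]; omega, hrot t ht⟩,
    hi t' ⟨by rw [length_initial]; omega, by rw [hrot t' ht', heq]⟩]

/-- Blocks that cover a set of indices have total length at least its size. -/
lemma card_le_sum_len (L : List Block) (s : Finset ℕ) (h : ∀ n ∈ s, ∃ γ ∈ L, γ.Covers n) :
    s.card ≤ (L.map Block.len).sum := by
  induction L generalizing s with
  | nil =>
    have hs : s = ∅ := Finset.eq_empty_of_forall_notMem fun n hn => by
      obtain ⟨γ, hγ, -⟩ := h n hn
      exact List.not_mem_nil hγ
    simp [hs]
  | cons β L ih =>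
    rw [List.map_cons, List.sum_cons,
      ← Finset.card_filter_add_card_filter_not (s := s)
        (fun n => n ∈ Finset.Ico β.start (β.start + β.len))]
    refine add_le_add ?_ (ih _ fun n hn => ?_)
    · have : s.filter (fun n => n ∈ Finset.Ico β.start (β.start + β.len))
          ⊆ Finset.Ico β.start (β.start + β.len) := fun n hn => (Finset.mem_filter.mp hn).2
      simpa using Finset.card_le_card this
    · obtain ⟨hns, hn'⟩ := Finset.mem_filter.mp hn
      obtain ⟨γ, hγ, hc⟩ := h n hns
      rcases List.mem_cons.mp hγ with rfl | hγ
      · exact absurd (Finset.mem_Ico.mpr hc) hn'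
      · exact ⟨γ, hγ, hc⟩

/-- The blocks selected up to step `k` lie in an initial segment of `A` that is a de Bruijn word of
some order `n ≤ k`. With two symbols, this uses that they fill an initial segment of length at most
`2 ^ (k - 1)`, since `p 0 ≥ 1 / 2`. -/
lemma IsSelection.exists_order [Fintype Ω] (hΩ : 2 ≤ Fintype.card Ω) {lam : ℝ} {A : ℕ → Ω}
    (hA : IsInfiniteDeBruijn A) {p : ℕ → ℝ} (hp : IsAdmissible (Fintype.card Ω) lam p)
    {S : ℕ → List Block} (hS : IsSelection (Fintype.card Ω) p S) {k : ℕ} (hk : 2 ≤ k) :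
    ∃ n, 1 ≤ n ∧ n ≤ k ∧ IsCyclicDeBruijn n (initial A (Fintype.card Ω ^ n)) ∧
      ∀ β ∈ selectedUpTo S k, β.start + β.len ≤ Fintype.card Ω ^ n := by
  rcases hΩ.lt_or_eq with h3 | h2
  · refine ⟨k, by omega, le_rfl, hA.1 h3 k (by omega), fun β hβ => ?_⟩
    obtain ⟨m, hm1, hm2, hm⟩ := mem_selectedUpTo.mp hβ
    exact (hS.fits m hm1 β hm).trans (Nat.pow_le_pow_right (by omega) hm2)
  · have hend : ∀ β ∈ selectedUpTo S k, β.start + β.len ≤ 2 ^ (k - 1) := by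
      intro β hβ
      have hlen : ((selectedUpTo S k).map Block.len).sum ≤ 2 ^ (k - 1) := by
        have h1 := hS.hasCounts.sum_len_le (by omega) hp (show 1 ≤ k by omega)
        rw [← h2] at h1
        have hhalf := hp.half_le h2.symm
        have h4 : ((2 : ℕ) : ℝ) ^ k = 2 * ((2 : ℕ) : ℝ) ^ (k - 1) := by
          rw [Nat.cast_ofNat, ← pow_succ']; congr 1; omega
        rw [h4] at h1
        have h5 : (0 : ℝ) < ((2 : ℕ) : ℝ) ^ (k - 1) := by positivity
        have h6 : ((((selectedUpTo S k).map Block.len).sum : ℕ) : ℝ)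
            ≤ ((2 : ℕ) : ℝ) ^ (k - 1) := by nlinarith
        exact_mod_cast h6
      have hcov : ∀ n ∈ Finset.range (β.start + β.len), ∃ γ ∈ selectedUpTo S k, γ.Covers n := by
        intro n hn
        rw [Finset.mem_range] at hn
        by_cases hns : n < β.start
        · exact hS.noGaps_two h2.symm k β hβ n hns
        · exact ⟨β, hβ, not_lt.mp hns, hn⟩
      simpa using (card_le_sum_len _ _ hcov).trans hlen
    have hodd : ∀ m, 1 ≤ m → IsCyclicDeBruijn (2 * m - 1)
        (initial A (Fintype.card Ω ^ (2 * m - 1))) := by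
      intro m hm
      have := hA.2 h2.symm m hm
      rwa [← h2]
    have hmod := Nat.mod_two_eq_zero_or_one k
    refine ⟨2 * ((k + 1) / 2) - 1, by omega, by omega, hodd _ (by omega), fun β hβ => ?_⟩
    refine (hend β hβ).trans ?_
    rw [← h2]
    exact Nat.pow_le_pow_right (by omega) (by omega)

variable [DecidableEq Ω]

/-- Non-overlapping blocks contain together at most one window with a given content, if the content
of a window determines its index. -/
lemma sum_occ_le_one {A : ℕ → Ω} {k : ℕ} (hk : 1 ≤ k) (w : Fin k → Ω) (L : List Block)
    (hdisj : L.Pairwise Block.Disjoint)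
    (hinj : ∀ β ∈ L, ∀ γ ∈ L, ∀ t t', β.start ≤ t → t + k ≤ β.start + β.len →
      γ.start ≤ t' → t' + k ≤ γ.start + γ.len → win A k t = win A k t' → t = t') :
    (L.map fun β => occ (List.ofFn w) (segment A β.start β.len)).sum ≤ 1 := by
  induction L with
  | nil => simp
  | cons β L ih =>
    rw [List.pairwise_cons] at hdisj
    have ih' := ih hdisj.2 fun γ hγ δ hδ =>
      hinj γ (List.mem_cons_of_mem _ hγ) δ (List.mem_cons_of_mem _ hδ)
    rw [List.map_cons, List.sum_cons]
    have hone : occ (List.ofFn w) (segment A β.start β.len) ≤ 1 := by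
      rw [occ_ofFn_segment, Finset.card_le_one]
      intro r hr r' hr'
      simp only [Finset.mem_filter, Finset.mem_range] at hr hr'
      have := hinj β List.mem_cons_self β List.mem_cons_self (β.start + r) (β.start + r')
        (by omega) (by omega) (by omega) (by omega) (hr.2.trans hr'.2.symm)
      omega
    rcases Nat.eq_zero_or_pos (occ (List.ofFn w) (segment A β.start β.len)) with h0 | h0
    · omega
    · have hrest : (L.map fun β => occ (List.ofFn w) (segment A β.start β.len)).sum = 0 := by
        rw [List.sum_eq_zero_iff]
        intro m hm
        obtain ⟨γ, hγ, rfl⟩ := List.mem_map.mp hm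
        rw [occ_ofFn_segment, gt_iff_lt, Finset.card_pos] at h0
        obtain ⟨r, hr⟩ := h0
        rw [occ_ofFn_segment, Finset.card_eq_zero, Finset.eq_empty_iff_forall_notMem]
        intro r' hr'
        simp only [Finset.mem_filter, Finset.mem_range] at hr hr'
        have := hinj β List.mem_cons_self γ (List.mem_cons_of_mem _ hγ) (β.start + r)
          (γ.start + r') (by omega) (by omega) (by omega) (by omega) (hr.2.trans hr'.2.symm)
        exact hdisj.1 γ hγ (β.start + r) ⟨⟨by omega, by omega⟩, ⟨by omega, by omega⟩⟩
      omega

/-- The number of occurrences of `w` in the output that lie inside one copy of a block. -/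
def innerOcc (A : ℕ → Ω) (L : List Block) {k : ℕ} (w : Fin k → Ω) : ℕ :=
  (L.map fun β => β.mult * occ (List.ofFn w) (segment A β.start β.len)).sum

/-- Occurrences in different copies of blocks are different occurrences in the output. -/
lemma innerOcc_le (A : ℕ → Ω) (L : List Block) {k : ℕ} (hk : 1 ≤ k) (w : Fin k → Ω) :
    innerOcc A L w ≤ occ (List.ofFn w) (L.flatMap (runSegment A)) := by
  have hw : List.ofFn w ≠ [] := by
    rw [← List.length_pos_iff, List.length_ofFn]; exact hk
  induction L with
  | nil => simp [innerOcc]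
  | cons β L ih =>
    rw [innerOcc, List.map_cons, List.sum_cons, List.flatMap_cons]
    exact (add_le_add (mul_occ_le_occ_flatten_replicate hw _ _) ih).trans (occ_append_le hw _ _)

variable [Fintype Ω]

lemma sum_occ_segment (A : ℕ → Ω) (k s n : ℕ) :
    ∑ w : Fin k → Ω, occ (List.ofFn w) (segment A s n) = n + 1 - k := by
  simp only [occ_ofFn_segment]
  rw [← Finset.card_eq_sum_card_fiberwise (fun _ _ => Finset.mem_coe.mpr (Finset.mem_univ _)),
    Finset.card_range]

lemma sum_list_sum_occ (A : ℕ → Ω) (k : ℕ) (L : List Block) (c : Block → ℕ) :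
    ∑ w : Fin k → Ω, (L.map fun β => c β * occ (List.ofFn w) (segment A β.start β.len)).sum
      = (L.map fun β => c β * (β.len + 1 - k)).sum := by
  induction L with
  | nil => simp
  | cons β L ih =>
    simp only [List.map_cons, List.sum_cons, Finset.sum_add_distrib, ih, ← Finset.mul_sum,
      sum_occ_segment]

/-- The number of windows of length `k` that lie in a block of `L` of multiplicity `i`. -/
def innerCount (L : List Block) (k i : ℕ) : ℕ :=
  ((ofMult L i).map fun β => β.len + 1 - k).sum

lemma mass_le_innerCount (L : List Block) (k i : ℕ) :
    mass L i ≤ innerCount L k i + k * (ofMult L i).length := by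
  unfold mass innerCount
  generalize ofMult L i = L'
  induction L' with
  | nil => simp
  | cons β L' ih =>
    simp only [List.map_cons, List.sum_cons, List.length_cons, mul_add, mul_one]
    omega

/-- As each window of `A` inside the blocks has its own content, those in blocks of multiplicity
`i` yield words that occur exactly `i` times inside copies of blocks. -/
lemma innerCount_le_card {A : ℕ → Ω} {k : ℕ} {L : List Block}
    (hone : ∀ w : Fin k → Ω, (L.map fun β => occ (List.ofFn w) (segment A β.start β.len)).sum ≤ 1)
    (i : ℕ) : innerCount L k i ≤ (Finset.univ.filter fun w : Fin k → Ω =>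
      innerOcc A L w = i).card := by
  have h1 := sum_list_sum_occ A k (ofMult L i) fun _ => 1
  simp only [one_mul] at h1
  rw [innerCount, ← h1, Finset.card_filter]
  refine Finset.sum_le_sum fun w _ => ?_
  -- the third part serves the induction: once `w` has occurred in a block, it does not occur in
  -- the later ones
  have hkey : ∀ L' : List Block,
      (L'.map fun β => occ (List.ofFn w) (segment A β.start β.len)).sum ≤ 1 →
      ((ofMult L' i).map fun β => occ (List.ofFn w) (segment A β.start β.len)).sum ≤ 1 ∧
      (((ofMult L' i).map fun β => occ (List.ofFn w) (segment A β.start β.len)).sum = 1 →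
        innerOcc A L' w = i) ∧
      ((L'.map fun β => occ (List.ofFn w) (segment A β.start β.len)).sum = 0 →
        innerOcc A L' w = 0 ∧
        ((ofMult L' i).map fun β => occ (List.ofFn w) (segment A β.start β.len)).sum = 0) := by
    intro L' hL'
    induction L' with
    | nil => simp [ofMult, innerOcc]
    | cons β L' ih =>
      rw [List.map_cons, List.sum_cons] at hL'
      obtain ⟨ih1, ih2, ih3⟩ := ih (by omega)
      unfold innerOcc at ih2 ih3 ⊢
      by_cases hm : β.mult = i
      · have hc : ofMult (β :: L') i = β :: ofMult L' i := by simp [ofMult, hm]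
        rw [hc]
        simp only [List.map_cons, List.sum_cons]
        rcases Nat.eq_zero_or_pos (occ (List.ofFn w) (segment A β.start β.len)) with h0 | h0
        · simp only [h0, zero_add, mul_zero]
          exact ⟨ih1, ih2, ih3⟩
        · have h1 : occ (List.ofFn w) (segment A β.start β.len) = 1 := by omega
          obtain ⟨h2, h3⟩ := ih3 (by omega)
          rw [h1, h2, h3]
          omega
      · have hc : ofMult (β :: L') i = ofMult L' i := by simp [ofMult, hm]
        rw [hc]
        simp only [List.map_cons, List.sum_cons]
        rcases Nat.eq_zero_or_pos (occ (List.ofFn w) (segment A β.start β.len)) with h0 | h0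
        · simp only [h0, zero_add, mul_zero]
          exact ⟨ih1, ih2, ih3⟩
        · obtain ⟨h2, h3⟩ := ih3 (by omega)
          rw [h3]
          omega
  obtain ⟨h2, h3, -⟩ := hkey L (hone w)
  split_ifs with hc
  · exact h2
  · by_contra hcon
    exact hc (h3 (by omega))

end WindowsOfOutput

/-! ### The limits of the proportions for an output -/

section Limit

variable {Ω : Type*}

lemma length_outputUpTo (A : ℕ → Ω) (S : ℕ → List Block) (k : ℕ) :
    (outputUpTo A S k).length = ((selectedUpTo S k).map fun β => β.mult * β.len).sum := by
  unfold outputUpTo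
  rw [List.length_flatMap]
  congr 1
  refine List.map_congr_left fun β _ => ?_
  simp [runSegment]

/-- The rounding error of step `k`, for the blocks of one multiplicity: the truncation of the
digits, and at most `k` windows at the end of each block. -/
def roundErr (b k : ℕ) : ℝ := k * (b : ℝ) ^ (k / 2) + k * (k * (k * b))

lemma tendsto_roundErr {b : ℕ} (hb : 2 ≤ b) :
    Tendsto (fun k => roundErr b k / (b : ℝ) ^ k) atTop (𝓝 0) := by
  have hb1 : (1 : ℝ) < b := by exact_mod_cast hb
  have hs1 : 1 < √(b : ℝ) := by rw [Real.lt_sqrt (by norm_num)]; simpa using hb1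
  have h1 : Tendsto (fun k : ℕ => (k : ℝ) ^ 1 / √(b : ℝ) ^ k) atTop (𝓝 0) :=
    tendsto_pow_const_div_const_pow_of_one_lt 1 hs1
  have h2 : Tendsto (fun k : ℕ => (k : ℝ) ^ 3 / (b : ℝ) ^ k) atTop (𝓝 0) :=
    tendsto_pow_const_div_const_pow_of_one_lt 3 hb1
  have h3 := h1.add (h2.mul_const (b : ℝ))
  simp only [pow_one, zero_mul, add_zero] at h3
  refine squeeze_zero (fun k => by unfold roundErr; positivity) (fun k => ?_) h3
  have hsq : √(b : ℝ) ^ k * √(b : ℝ) ^ k = (b : ℝ) ^ k := by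
    rw [← mul_pow, Real.mul_self_sqrt (by positivity)]
  have hhalf : (b : ℝ) ^ (k / 2) ≤ √(b : ℝ) ^ k := by
    calc (b : ℝ) ^ (k / 2) = √(b : ℝ) ^ (2 * (k / 2)) := by
          rw [pow_mul, Real.sq_sqrt (by positivity)]
      _ ≤ √(b : ℝ) ^ k := pow_le_pow_right₀ hs1.le (by omega)
  have hspos : 0 < √(b : ℝ) ^ k := by positivity
  rw [roundErr, ← hsq, div_le_iff₀ (by positivity)]
  calc (k : ℝ) * (b : ℝ) ^ (k / 2) + k * (k * (k * b))
      ≤ k * √(b : ℝ) ^ k + k * (k * (k * b)) := by gcongr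
    _ = (k / √(b : ℝ) ^ k + k ^ 3 / (√(b : ℝ) ^ k * √(b : ℝ) ^ k) * b)
          * (√(b : ℝ) ^ k * √(b : ℝ) ^ k) := by
        field_simp

variable [Fintype Ω] [DecidableEq Ω]

/-- The words that occur exactly `i` times in the output are at least about as many as the
selected blocks of multiplicity `i` provide. Occurrences outside copies of blocks are few, as the
first `I` multiplicities already account for nearly all of the `lam * b ^ k` windows. -/
lemma le_card_hits_eq (hΩ : 2 ≤ Fintype.card Ω) {lam : ℝ} (hlam : 0 < lam) {A : ℕ → Ω}
    (hA : IsInfiniteDeBruijn A) {p : ℕ → ℝ} (hp : IsAdmissible (Fintype.card Ω) lam p)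
    {S : ℕ → List Block} (hS : IsSelection (Fintype.card Ω) p S) {x : ℕ → Ω}
    (hx : ∀ k, outputUpTo A S k = initial x (outputUpTo A S k).length) {k : ℕ} (hk : 2 ≤ k)
    {i : ℕ} (hi : 1 ≤ i) (I : ℕ) :
    (p i - (lam - ∑ j ∈ Finset.range I, (j : ℝ) * p j)) * (Fintype.card Ω : ℝ) ^ k ≤
      ((Finset.univ.filter fun w : Fin k → Ω =>
        hits x k ⌊lam * (Fintype.card Ω : ℝ) ^ k⌋₊ w = i).card : ℝ) +
        roundErr (Fintype.card Ω) k * (1 + ∑ j ∈ Finset.range I, (j : ℝ)) := by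
  set b := Fintype.card Ω with hb
  set N := ⌊lam * (b : ℝ) ^ k⌋₊ with hN
  set L := selectedUpTo S k with hL
  have hNle : (N : ℝ) ≤ lam * (b : ℝ) ^ k := Nat.floor_le (by positivity)
  -- each content appears at most once in the blocks
  have hone : ∀ w : Fin k → Ω,
      (L.map fun β => occ (List.ofFn w) (segment A β.start β.len)).sum ≤ 1 := by
    obtain ⟨n, hn1, hnk, hn, hend⟩ := hS.exists_order hΩ hA hp hk
    refine fun w => sum_occ_le_one (by omega) w L (hS.disjoint k) ?_
    intro β hβ γ hγ t t' _ ht _ ht' heq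
    have h1 := hend β hβ
    have h2 := hend γ hγ
    refine hn.segment_inj hn1 (by omega) (by omega) ?_
    rw [← ofFn_win, ← ofFn_win, List.ofFn_inj]
    funext m
    exact congrFun heq ⟨m, by omega⟩
  -- the occurrences inside copies of blocks are among the windows that count
  have hle : ∀ w : Fin k → Ω, innerOcc A L w ≤ hits x k N w := by
    intro w
    refine (innerOcc_le A L (by omega) w).trans ?_
    have hxk := hx k
    unfold outputUpTo at hxk
    rw [hxk, occ_ofFn_initial]
    refine hits_mono x k ?_ w
    have h1 := hS.hasCounts.sum_mult_mul_len_le hΩ hp (show 1 ≤ k by omega)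
    rw [← length_outputUpTo A] at h1
    have h2 : (outputUpTo A S k).length ≤ N := Nat.le_floor h1
    unfold outputUpTo at h2
    omega
  have hcount : ∀ j, 1 ≤ j →
      p j * (b : ℝ) ^ k - roundErr b k ≤ (innerCount L k j : ℝ) := by
    intro j hj
    have h1 := (hS.hasCounts.mass_bounds hΩ hp (show 1 ≤ k by omega) hj).2
    have h2 : (mass L j : ℝ) ≤ innerCount L k j + k * (k * (k * b)) := by
      have h3 := hS.hasCounts.length_ofMult_le hΩ k hj
      have h4 := (mass_le_innerCount L k j).trans
        (Nat.add_le_add_left (Nat.mul_le_mul_left k h3) _)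
      exact_mod_cast h4
    unfold roundErr
    linarith
  have hinner : (Finset.univ.filter fun w : Fin k → Ω => innerOcc A L w = i).card ≤
      (Finset.univ.filter fun w : Fin k → Ω => hits x k N w = i).card +
        (Finset.univ.filter fun w : Fin k → Ω => hits x k N w ≠ innerOcc A L w).card := by
    refine (Finset.card_le_card fun w hw => ?_).trans (Finset.card_union_le _ _)
    simp only [Finset.mem_union, Finset.mem_filter, Finset.mem_univ, true_and] at hw ⊢
    by_cases h : hits x k N w = innerOcc A L w
    · exact Or.inl (h.trans hw)
    · exact Or.inr h
  have herr : (Finset.univ.filter fun w : Fin k → Ω => hits x k N w ≠ innerOcc A L w).card +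
      ∑ j ∈ Finset.range I, j * innerCount L k j ≤ N := by
    have h1 : ∑ j ∈ Finset.range I, j * innerCount L k j ≤ ∑ w : Fin k → Ω, innerOcc A L w := by
      obtain ⟨M, hM⟩ := exists_mult_lt L
      have h2 : ∑ w : Fin k → Ω, innerOcc A L w
          = ∑ j ∈ Finset.range (max M I), j * innerCount L k j := by
        unfold innerOcc
        rw [sum_list_sum_occ A k L, sum_map_eq_sum_ofMult L _
          (fun β hβ => (hM β hβ).trans_le (le_max_left M I))]
        exact Finset.sum_congr rfl fun j _ => sum_map_mult_mul L j fun β => β.len + 1 - k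
      rw [h2]
      exact Finset.sum_le_sum_of_subset (Finset.range_mono (le_max_right M I))
    refine (Nat.add_le_add_left h1 _).trans ?_
    rw [Finset.card_filter, ← Finset.sum_add_distrib]
    refine (Finset.sum_le_sum fun w _ => ?_).trans (sum_hits x k N).le
    have := hle w
    split_ifs with h <;> omega
  have hsum : (∑ j ∈ Finset.range I, (j : ℝ) * p j) * (b : ℝ) ^ k
      - roundErr b k * ∑ j ∈ Finset.range I, (j : ℝ)
      ≤ ∑ j ∈ Finset.range I, (j : ℝ) * (innerCount L k j : ℝ) := by
    rw [Finset.sum_mul, Finset.mul_sum, ← Finset.sum_sub_distrib]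
    refine Finset.sum_le_sum fun j _ => ?_
    rcases Nat.eq_zero_or_pos j with rfl | hj
    · simp
    · have := mul_le_mul_of_nonneg_left (hcount j hj) (Nat.cast_nonneg (α := ℝ) j)
      linarith
  have h1 : (innerCount L k i : ℝ) ≤
      ((Finset.univ.filter fun w : Fin k → Ω => hits x k N w = i).card : ℝ) +
        (Finset.univ.filter fun w : Fin k → Ω => hits x k N w ≠ innerOcc A L w).card := by
    exact_mod_cast (innerCount_le_card hone i).trans hinner
  have h2 : ((Finset.univ.filter fun w : Fin k → Ω =>
      hits x k N w ≠ innerOcc A L w).card : ℝ) +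
        ∑ j ∈ Finset.range I, (j : ℝ) * (innerCount L k j : ℝ) ≤ N := by
    exact_mod_cast herr
  have h3 := hcount i hi
  linarith

/-- For an output of the construction, the proportion of words of length `k` that occur `i` times
converges to `p i`. -/
theorem IsOutput.tendsto_Z (hΩ : 2 ≤ Fintype.card Ω) {lam : ℝ} (hlam : 0 < lam) {A : ℕ → Ω}
    (hA : IsInfiniteDeBruijn A) {p : ℕ → ℝ} (hp : IsAdmissible (Fintype.card Ω) lam p)
    {x : ℕ → Ω} (hx : IsOutput A p x) (i : ℕ) :
    Tendsto (fun k => Z lam i k x) atTop (𝓝 (p i)) := by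
  obtain ⟨S, hS, hx⟩ := hx
  have hbpos : (0 : ℝ) < Fintype.card Ω := by
    exact_mod_cast (by omega : 0 < Fintype.card Ω)
  have hcard : ∀ (k I : ℕ), ∑ j ∈ Finset.range I, (Finset.univ.filter fun w : Fin k → Ω =>
      hits x k ⌊lam * (Fintype.card Ω : ℝ) ^ k⌋₊ w = j).card
      = (Finset.univ.filter fun w : Fin k → Ω =>
        hits x k ⌊lam * (Fintype.card Ω : ℝ) ^ k⌋₊ w < I).card := by
    intro k I
    rw [Finset.card_eq_sum_card_fiberwise (t := Finset.range I)
      (f := fun w => hits x k ⌊lam * (Fintype.card Ω : ℝ) ^ k⌋₊ w)]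
    · refine Finset.sum_congr rfl fun j hj => ?_
      rw [Finset.filter_filter]
      congr 1
      refine Finset.filter_congr fun w _ => ?_
      rw [Finset.mem_range] at hj
      omega
    · intro w hw
      simpa using hw
  refine tendsto_of_eventually_ge (Y := fun i k => Z lam i k x) hp.hasSum_one hp.hasSum_mean
    ?_ ?_ ?_ ?_ i
  · filter_upwards [eventually_ge_atTop 1] with k hk I
    simp only [Z_eq lam _ hk]
    rw [← Finset.sum_div, div_le_one (by positivity), ← Nat.cast_sum, hcard]
    have := Finset.card_le_univ (Finset.univ.filter fun w : Fin k → Ω =>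
        hits x k ⌊lam * (Fintype.card Ω : ℝ) ^ k⌋₊ w < I)
    rw [Fintype.card_fun, Fintype.card_fin] at this
    exact_mod_cast this
  · filter_upwards [eventually_ge_atTop 1] with k hk I
    simp only [Z_eq lam _ hk]
    simp only [mul_div_assoc']
    rw [← Finset.sum_div, div_le_iff₀ (by positivity)]
    refine le_trans ?_ (Nat.floor_le (by positivity :
      0 ≤ lam * (Fintype.card Ω : ℝ) ^ k))
    have h1 : ∑ j ∈ Finset.range I, j * (Finset.univ.filter fun w : Fin k → Ω =>
        hits x k ⌊lam * (Fintype.card Ω : ℝ) ^ k⌋₊ w = j).card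
        ≤ ⌊lam * (Fintype.card Ω : ℝ) ^ k⌋₊ := by
      refine (Finset.sum_le_sum_of_subset (Finset.range_mono (Nat.le_succ I))).trans ?_
      rw [sum_small_hits]
      exact (Finset.sum_le_sum_of_subset (Finset.filter_subset _ _)).trans (sum_hits x k _).le
    exact_mod_cast h1
  · filter_upwards [eventually_ge_atTop 1] with k hk I
    have hbk : (0 : ℝ) < (Fintype.card Ω : ℝ) ^ k := by positivity
    simp only [Z_eq lam _ hk]
    simp only [mul_div_assoc']
    rw [← Finset.sum_div, ← Finset.sum_div, ← sub_le_iff_le_add, add_sub_assoc, ← sub_div,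
      ← le_sub_iff_add_le', div_le_iff₀ hbk, sub_mul, one_mul]
    set N := ⌊lam * (Fintype.card Ω : ℝ) ^ k⌋₊ with hN
    have hNle : (N : ℝ) ≤ lam * (Fintype.card Ω : ℝ) ^ k := Nat.floor_le (by positivity)
    have h1 : ∑ j ∈ Finset.range (I + 1), j * (Finset.univ.filter fun w : Fin k → Ω =>
        hits x k N w = j).card + Fintype.card Ω ^ k ≤ N +
        ∑ j ∈ Finset.range (I + 1), (Finset.univ.filter fun w : Fin k → Ω =>
          hits x k N w = j).card := by
      have h2 := sum_hits x k N
      rw [← Finset.sum_filter_add_sum_filter_not _ (fun w => hits x k N w ≤ I)] at h2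
      have h3 : (Finset.univ.filter fun w : Fin k → Ω => ¬ hits x k N w ≤ I).card
          ≤ ∑ w with ¬ hits x k N w ≤ I, hits x k N w := by
        rw [Finset.card_eq_sum_ones]
        refine Finset.sum_le_sum fun w hw => ?_
        have := (Finset.mem_filter.mp hw).2
        omega
      have h4 := Finset.card_filter_add_card_filter_not (s := (Finset.univ : Finset (Fin k → Ω)))
        (fun w => hits x k N w ≤ I)
      rw [Finset.card_univ, Fintype.card_fun, Fintype.card_fin] at h4
      rw [sum_small_hits, hcard, ← hN]
      simp only [Nat.lt_succ_iff]
      omega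
    have h2 : ((∑ j ∈ Finset.range (I + 1), j * (Finset.univ.filter fun w : Fin k → Ω =>
        hits x k N w = j).card + Fintype.card Ω ^ k : ℕ) : ℝ) ≤ ((N +
        ∑ j ∈ Finset.range (I + 1), (Finset.univ.filter fun w : Fin k → Ω =>
          hits x k N w = j).card : ℕ) : ℝ) := by exact_mod_cast h1
    push_cast at h2
    linarith
  · intro i hi ε hε
    obtain ⟨I, hI⟩ : ∃ I : ℕ, lam - ε / 2 < ∑ j ∈ Finset.range I, (j : ℝ) * p j :=
      ((hp.hasSum_mean.tendsto_sum_nat.eventually (lt_mem_nhds (by linarith)))).exists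
    have h1 : Tendsto (fun k => roundErr (Fintype.card Ω) k / (Fintype.card Ω : ℝ) ^ k
        * (1 + ∑ j ∈ Finset.range I, (j : ℝ))) atTop (𝓝 0) := by
      simpa using (tendsto_roundErr hΩ).mul_const (1 + ∑ j ∈ Finset.range I, (j : ℝ))
    filter_upwards [h1.eventually (gt_mem_nhds (half_pos hε)), eventually_ge_atTop 2]
      with k hk1 hk
    have hbk : (0 : ℝ) < (Fintype.card Ω : ℝ) ^ k := by positivity
    have h2 := le_card_hits_eq hΩ hlam hA hp hS hx hk hi I
    rw [Z_eq lam i (by omega), le_div_iff₀ hbk]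
    rw [div_mul_eq_mul_div, div_lt_iff₀ hbk] at hk1
    nlinarith

end Limit

/-! ### Existence of selections and outputs -/

section Existence

/-- Blocks of the given multiplicities and lengths, one after another from index `s` on. -/
def place : ℕ → List (ℕ × ℕ) → List Block
  | _, [] => []
  | s, a :: l => ⟨s, a.2, a.1⟩ :: place (s + a.2) l

lemma map_place (s : ℕ) (l : List (ℕ × ℕ)) :
    (place s l).map (fun β => (β.mult, β.len)) = l := by
  induction l generalizing s with
  | nil => rfl
  | cons a l ih => simp [place, ih]

lemma sum_len_place (s : ℕ) (l : List (ℕ × ℕ)) :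
    ((place s l).map Block.len).sum = (l.map Prod.snd).sum := by
  conv_rhs => rw [← map_place s l, List.map_map]
  rfl

lemma place_append (s : ℕ) (l l' : List (ℕ × ℕ)) :
    place s (l ++ l') = place s l ++ place (s + (l.map Prod.snd).sum) l' := by
  induction l generalizing s with
  | nil => simp [place]
  | cons a l ih => simp [place, ih, add_assoc]

lemma mem_place {s : ℕ} {l : List (ℕ × ℕ)} {β : Block} (h : β ∈ place s l) :
    s ≤ β.start ∧ β.start + β.len ≤ s + (l.map Prod.snd).sum := by
  induction l generalizing s with
  | nil => simp [place] at h
  | cons a l ih =>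
    rw [place, List.mem_cons] at h
    rw [List.map_cons, List.sum_cons]
    rcases h with rfl | h
    · simp only; omega
    · have := ih h; omega

lemma pairwise_place (s : ℕ) (l : List (ℕ × ℕ)) : (place s l).Pairwise Block.Disjoint := by
  induction l generalizing s with
  | nil => exact List.Pairwise.nil
  | cons a l ih =>
    refine List.Pairwise.cons (fun β hβ n hn => ?_) (ih _)
    have := (mem_place hβ).1
    simp only [Block.Covers] at hn
    omega

lemma exists_covers_place {s : ℕ} {l : List (ℕ × ℕ)} {n : ℕ} (hn : s ≤ n)
    (hn' : n < s + (l.map Prod.snd).sum) : ∃ γ ∈ place s l, γ.Covers n := by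
  induction l generalizing s with
  | nil => simp at hn'; omega
  | cons a l ih =>
    rw [List.map_cons, List.sum_cons] at hn'
    by_cases h : n < s + a.2
    · exact ⟨⟨s, a.2, a.1⟩, List.mem_cons_self, hn, h⟩
    · obtain ⟨γ, hγ, hc⟩ := ih (s := s + a.2) (by omega) (by omega)
      exact ⟨γ, List.mem_cons_of_mem _ hγ, hc⟩

lemma noGaps_place (l : List (ℕ × ℕ)) : NoGaps (place 0 l) := by
  intro β hβ n hn
  have := (mem_place hβ).2
  exact exists_covers_place (Nat.zero_le n) (by omega)

/-- The multiplicities and lengths of the blocks of step `k`, up to the multiplicity `M`. -/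
noncomputable def blockSizes (b : ℕ) (p : ℕ → ℝ) (M k : ℕ) : List (ℕ × ℕ) :=
  (List.range M).flatMap fun i => (List.range (numDigits k)).flatMap fun j =>
    List.replicate (digit b (target b p k (i + 1)) (j + 1)) (i + 1, b ^ (k - (j + 1)))

lemma sum_map_range (f : ℕ → ℕ) (n : ℕ) :
    ((List.range n).map f).sum = ∑ i ∈ Finset.range n, f i := by
  induction n with
  | zero => rfl
  | succ n ih => rw [List.range_succ, Finset.sum_range_succ, ← ih]; simp

lemma count_blockSizes {b : ℕ} (hb : 2 ≤ b) (p : ℕ → ℝ) {M k i j : ℕ} (hk : 1 ≤ k)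
    (hM : ∀ i, M < i → ∀ j, j ≤ numDigits k → digit b (target b p k i) j = 0)
    (hi : 1 ≤ i) (hj : 1 ≤ j) (hj' : j ≤ numDigits k) :
    (blockSizes b p M k).count (i, b ^ (k - j)) = digit b (target b p k i) j := by
  have hnk := numDigits_le hk
  have hinner : ∀ i', (List.map (List.count (i, b ^ (k - j)) ∘ fun j' =>
      List.replicate (digit b (target b p k (i' + 1)) (j' + 1)) (i' + 1, b ^ (k - (j' + 1))))
      (List.range (numDigits k))).sum
      = if i' + 1 = i then digit b (target b p k i) j else 0 := by
    intro i'
    rw [sum_map_range]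
    by_cases h : i' + 1 = i
    · rw [if_pos h, Finset.sum_eq_single (j - 1)]
      · simp [h, Nat.sub_add_cancel hj]
      · intro j' hj1 hj2
        rw [Finset.mem_range] at hj1
        simp only [Function.comp, List.count_replicate, beq_iff_eq, Prod.mk.injEq]
        refine if_neg fun hc => hj2 ?_
        have := Nat.pow_right_injective hb hc.2
        omega
      · intro hj1; exact absurd (Finset.mem_range.mpr (by omega)) hj1
    · rw [if_neg h]
      refine Finset.sum_eq_zero fun j' _ => ?_
      simp [List.count_replicate, h]
  rw [blockSizes, List.count_flatMap, sum_map_range]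
  simp only [Function.comp_apply, List.count_flatMap]
  rw [Finset.sum_congr rfl fun i' _ => hinner i']
  by_cases h : i ≤ M
  · rw [Finset.sum_eq_single (i - 1)]
    · rw [if_pos (by omega)]
    · intro i' _ hne; exact if_neg (by omega)
    · intro hn; exact absurd (Finset.mem_range.mpr (by omega)) hn
  · rw [hM i (by omega) j hj']
    refine Finset.sum_eq_zero fun i' hi' => if_neg ?_
    rw [Finset.mem_range] at hi'
    omega

lemma IsAdmissible.exists_digit_eq_zero {b : ℕ} (hb : 2 ≤ b) {lam : ℝ} {p : ℕ → ℝ}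
    (hp : IsAdmissible b lam p) (k : ℕ) :
    ∃ M, ∀ i, M < i → ∀ j, j ≤ numDigits k → digit b (target b p k i) j = 0 := by
  have hb1 : (1 : ℝ) ≤ b := by exact_mod_cast (by omega : 1 ≤ b)
  have hlim : Tendsto (fun i => p i * (b : ℝ) ^ numDigits k) atTop (𝓝 0) := by
    simpa using hp.hasSum_one.summable.tendsto_atTop_zero.mul_const ((b : ℝ) ^ numDigits k)
  obtain ⟨M, hM⟩ := eventually_atTop.mp (hlim.eventually (gt_mem_nhds one_pos))
  refine ⟨M, fun i hi j hj => ?_⟩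
  have h1 := hM i hi.le
  have h0 := hp.nonneg i
  have hle : target b p k i ≤ p i := by
    unfold target
    split_ifs
    · exact le_rfl
    · exact mul_le_of_le_one_left h0 ((div_le_one (by linarith)).mpr (by linarith))
  have h2 : target b p k i * (b : ℝ) ^ j < 1 := by
    refine lt_of_le_of_lt ?_ h1
    exact mul_le_mul hle (pow_le_pow_right₀ hb1 hj) (by positivity) h0
  have h3 : target b p k i ≠ 1 := by
    intro h
    have : (1 : ℝ) ≤ (b : ℝ) ^ j := one_le_pow₀ hb1
    rw [h] at h2
    linarith
  rw [digit, if_neg h3, Nat.floor_eq_zero.mpr h2, Nat.zero_mod]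

/-- Placing the blocks one after another is an admitted selection: their total length up to step
`k` is at most `b ^ k`. -/
theorem IsAdmissible.exists_isSelection {b : ℕ} (hb : 2 ≤ b) {lam : ℝ} {p : ℕ → ℝ}
    (hp : IsAdmissible b lam p) : ∃ S, IsSelection b p S := by
  choose M hM using fun k => hp.exists_digit_eq_zero hb k
  let sizes : ℕ → List (ℕ × ℕ) := fun k => blockSizes b p (M k) k
  let upTo : ℕ → List (ℕ × ℕ) := fun k => (List.range k).flatMap fun m => sizes (m + 1)
  let S : ℕ → List Block := fun k => place ((upTo (k - 1)).map Prod.snd).sum (sizes k)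
  have hsel : ∀ k, selectedUpTo S k = place 0 (upTo k) := by
    intro k
    induction k with
    | zero => rfl
    | succ k ih =>
      have h1 : upTo (k + 1) = upTo k ++ sizes (k + 1) := by
        simp [upTo, List.range_succ, List.flatMap_append]
      rw [selectedUpTo_succ, ih, h1, place_append, zero_add]
      rfl
  have hcounts : HasCounts b p S := by
    refine ⟨fun k hk i hi j hj hj' => ?_, fun k hk β hβ => ?_⟩
    · rw [← count_blockSizes hb p hk (hM k) hi hj hj', List.count,
        show blockSizes b p (M k) k = (S k).map fun β => (β.mult, β.len) from
          (map_place _ _).symm, List.countP_map]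
      refine List.countP_congr fun β _ => ?_
      simp
    · have h1 : (β.mult, β.len) ∈ blockSizes b p (M k) k := by
        rw [← map_place ((upTo (k - 1)).map Prod.snd).sum (blockSizes b p (M k) k)]
        exact List.mem_map.mpr ⟨β, hβ, rfl⟩
      simp only [blockSizes, List.mem_flatMap, List.mem_range, List.mem_replicate,
        Prod.mk.injEq] at h1
      obtain ⟨i, -, j, hj, -, h2, h3⟩ := h1
      exact ⟨by omega, j + 1, by omega, by omega, h3⟩
  refine ⟨S, hcounts.count_eq, hcounts.shape, fun k hk β hβ => ?_, fun k => ?_, ?_, fun _ k => ?_⟩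
  · have h1 : β ∈ selectedUpTo S k := mem_selectedUpTo.mpr ⟨k, hk, le_rfl, hβ⟩
    rw [hsel] at h1
    have h2 := hcounts.sum_len_le hb hp hk
    rw [hsel, sum_len_place] at h2
    have h3 : (((upTo k).map Prod.snd).sum : ℝ) ≤ ((b ^ k : ℕ) : ℝ) := by
      push_cast at h2 ⊢
      have h4 : (0 : ℝ) ≤ (b : ℝ) ^ k := by positivity
      have h5 := hp.nonneg 0
      nlinarith
    have h6 : ((upTo k).map Prod.snd).sum ≤ b ^ k := by exact_mod_cast h3
    have := (mem_place h1).2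
    omega
  · rw [hsel]; exact pairwise_place _ _
  · rw [hsel]; exact noGaps_place _
  · rw [hsel]; exact noGaps_place _

lemma outputUpTo_prefix {Ω : Type*} (A : ℕ → Ω) (S : ℕ → List Block) {k m : ℕ} (h : k ≤ m) :
    outputUpTo A S k <+: outputUpTo A S m := by
  induction m, h using Nat.le_induction with
  | base => exact List.prefix_rfl
  | succ m _ ih =>
    refine ih.trans ?_
    rw [outputUpTo, outputUpTo, selectedUpTo_succ, List.flatMap_append]
    exact List.prefix_append _ _

/-- There is a selection, and the finite outputs obtained from it extend each other, so they have a
limit. -/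
theorem IsAdmissible.exists_isOutput {Ω : Type*} [Fintype Ω] (hΩ : 2 ≤ Fintype.card Ω) {lam : ℝ}
    {p : ℕ → ℝ} (hp : IsAdmissible (Fintype.card Ω) lam p) (A : ℕ → Ω) :
    ∃ x, IsOutput A p x := by
  obtain ⟨S, hS⟩ := hp.exists_isSelection hΩ
  classical
  refine ⟨fun n => if h : ∃ k, n < (outputUpTo A S k).length
    then (outputUpTo A S h.choose)[n]'h.choose_spec else A 0, S, hS, fun k => ?_⟩
  apply List.ext_getElem
  · simp
  · intro n h1 h2
    have hex : ∃ k, n < (outputUpTo A S k).length := ⟨k, h1⟩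
    refine Eq.trans ?_ (getElem_segment _ 0 _ n h2).symm
    simp only [zero_add, dif_pos hex]
    rcases le_total k hex.choose with h | h
    · exact (outputUpTo_prefix A S h).getElem h1
    · exact ((outputUpTo_prefix A S h).getElem hex.choose_spec).symm

end Existence

/-! ### Merging closed trails -/

section Merging

variable {E V : Type*}

/-- Exchanging the images of two elements `e` and `f` of different cycles puts the cycle of `e`
into the cycle of `f`. -/
lemma sameCycle_mul_swap [Finite E] [DecidableEq E] {σ : Equiv.Perm E} {e f : E}
    (hef : ¬ σ.SameCycle e f) {y : E} (hy : σ.SameCycle e y) :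
    (σ * Equiv.swap e f).SameCycle f y := by
  have hn : ∀ n : ℕ, (σ * Equiv.swap e f).SameCycle f ((σ ^ (n + 1)) e) := by
    intro n
    induction n with
    | zero =>
      have : (σ * Equiv.swap e f) f = σ e := by simp
      rw [zero_add, pow_one, ← this]
      exact Equiv.Perm.sameCycle_apply_right.mpr (Equiv.Perm.SameCycle.refl _ _)
    | succ n ih =>
      rw [pow_succ', Equiv.Perm.mul_apply]
      by_cases hz : (σ ^ (n + 1)) e = e
      · rw [hz]
        have : (σ * Equiv.swap e f) f = σ e := by simp
        rw [← this]
        exact Equiv.Perm.sameCycle_apply_right.mpr (Equiv.Perm.SameCycle.refl _ _)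
      · have hzf : (σ ^ (n + 1)) e ≠ f := fun h => hef ⟨(n + 1 : ℕ), by rw [zpow_natCast, h]⟩
        have : (σ * Equiv.swap e f) ((σ ^ (n + 1)) e) = σ ((σ ^ (n + 1)) e) := by
          rw [Equiv.Perm.mul_apply, Equiv.swap_apply_of_ne_of_ne hz hzf]
        rw [← this]
        exact Equiv.Perm.sameCycle_apply_right.mpr ih
  obtain ⟨i, hi, -, rfl⟩ := hy.exists_pow_eq''
  obtain ⟨j, rfl⟩ : ∃ j, i = j + 1 := ⟨i - 1, by omega⟩
  exact hn j

/-- Let `E` be the edges of a digraph, `t` the terminal vertex, and let `σ₀` continue each edge at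
its end by a further edge, so that the cycles of `σ₀` are closed trails. If the closed trails can be
merged into one at the edges of `M`, by exchanging the continuations of two edges with the same
terminal vertex, then there is a single closed trail through all edges, which outside `M` continues
as `σ₀` does. -/
lemma exists_single_cycle [Finite E] (t : E → V) (σ₀ : Equiv.Perm E) (M : Set E) (e₀ : E)
    (hconn : ∀ O : Set E, e₀ ∈ O → (∀ e, σ₀ e ∈ O ↔ e ∈ O) →
      (∀ e ∈ O, e ∈ M → ∀ f ∈ M, t f = t e → f ∈ O) → ∀ e, e ∈ O) :
    ∃ σ : Equiv.Perm E, (∀ e, e ∉ M → σ e = σ₀ e) ∧ (∀ e, ∃ e', t e' = t e ∧ σ e = σ₀ e') ∧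
      ∀ e, σ.SameCycle e₀ e := by
  classical
  let Q : Set (Equiv.Perm E) := {π | (∀ e, t (π e) = t e) ∧ ∀ e, e ∉ M → π e = e}
  obtain ⟨π, ⟨hπt, hπM⟩, hmax⟩ := Set.exists_max_image Q
    (fun π => {e | (σ₀ * π).SameCycle e₀ e}.ncard) Q.toFinite ⟨1, by simp [Q]⟩
  refine ⟨σ₀ * π, fun e he => by rw [Equiv.Perm.mul_apply, hπM e he],
    fun e => ⟨π e, hπt e, rfl⟩, ?_⟩
  have hclosed : ∀ e ∈ {e | (σ₀ * π).SameCycle e₀ e}, e ∈ M → ∀ f ∈ M, t f = t e →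
      f ∈ {e | (σ₀ * π).SameCycle e₀ e} := by
    intro e he heM f hfM htf
    by_contra hf
    have hef : ¬ (σ₀ * π).SameCycle e f := fun h => hf (Equiv.Perm.SameCycle.trans he h)
    have hπ' : π * Equiv.swap e f ∈ Q := by
      refine ⟨fun x => ?_, fun x hx => ?_⟩
      · rw [Equiv.Perm.mul_apply, hπt]
        rcases eq_or_ne x e with rfl | hxe
        · rw [Equiv.swap_apply_left, htf]
        · rcases eq_or_ne x f with rfl | hxf
          · rw [Equiv.swap_apply_right, htf]
          · rw [Equiv.swap_apply_of_ne_of_ne hxe hxf]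
      · rw [Equiv.Perm.mul_apply, Equiv.swap_apply_of_ne_of_ne, hπM x hx]
        · rintro rfl; exact hx heM
        · rintro rfl; exact hx hfM
    have hfy : ∀ y, (σ₀ * π).SameCycle e y →
        (σ₀ * (π * Equiv.swap e f)).SameCycle f y := fun y hy => by
      rw [← mul_assoc]; exact sameCycle_mul_swap hef hy
    have he₀ := hfy e₀ (Equiv.Perm.SameCycle.symm he)
    have hlt : {y | (σ₀ * π).SameCycle e₀ y}.ncard
        < {y | (σ₀ * (π * Equiv.swap e f)).SameCycle e₀ y}.ncard := by
      refine Set.ncard_lt_ncard (Set.ssubset_iff_of_subset ?_ |>.mpr ⟨f, he₀.symm, hf⟩)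
        (Set.toFinite _)
      intro y hy
      exact he₀.symm.trans (hfy y (Equiv.Perm.SameCycle.trans (Equiv.Perm.SameCycle.symm he) hy))
    exact absurd (hmax _ hπ') (not_le.mpr hlt)
  refine hconn {e | (σ₀ * π).SameCycle e₀ e} (Equiv.Perm.SameCycle.refl _ _) (fun e => ?_) hclosed
  have h1 : σ₀ e ∈ {e | (σ₀ * π).SameCycle e₀ e} ↔ π⁻¹ e ∈ {e | (σ₀ * π).SameCycle e₀ e} := by
    have : σ₀ e = (σ₀ * π) (π⁻¹ e) := by simp
    rw [this]
    exact Equiv.Perm.sameCycle_apply_right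
  rw [h1]
  have hinv : π (π⁻¹ e) = e := by simp
  by_cases heM : e ∈ M
  · have ht : t (π⁻¹ e) = t e := by
      have := hπt (π⁻¹ e)
      rw [hinv] at this
      exact this.symm
    have hM : π⁻¹ e ∈ M := by
      by_contra h
      have := hπM _ h
      rw [hinv] at this
      rw [← this] at h
      exact h heM
    exact ⟨fun h => hclosed _ h hM e heM ht.symm, fun h => hclosed _ h heM _ hM ht⟩
  · have : π⁻¹ e = e := by rw [Equiv.Perm.inv_eq_iff_eq, hπM e heM]
    rw [this]

end Merging

/-! ### Extending de Bruijn words -/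

section Extension

variable {Ω : Type*}

/-- The word with first letter `a`, last letter `c` and `s` in between. -/
def edge {n : ℕ} (a : Ω) (s : Fin n → Ω) (c : Ω) : Fin (n + 2) → Ω :=
  Fin.cons a (Fin.snoc s c : Fin (n + 1) → Ω)

lemma tail_edge {n : ℕ} (a : Ω) (s : Fin n → Ω) (c : Ω) :
    Fin.tail (edge a s c) = (Fin.snoc s c : Fin (n + 1) → Ω) := by
  rw [edge, Fin.tail_cons]

lemma init_edge {n : ℕ} (a : Ω) (s : Fin n → Ω) (c : Ω) :
    Fin.init (edge a s c) = (Fin.cons a s : Fin (n + 1) → Ω) := by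
  rw [edge, Fin.cons_snoc_eq_snoc_cons, Fin.init_snoc]

lemma edge_eq {n : ℕ} (e : Fin (n + 2) → Ω) :
    edge (e 0) (Fin.tail (Fin.init e)) (e (Fin.last _)) = e := by
  rw [edge]
  conv_rhs => rw [← Fin.cons_self_tail e]
  congr 1
  conv_rhs => rw [← Fin.snoc_init_self (Fin.tail e)]
  rfl

lemma tail_win (u : ℕ → Ω) (k t : ℕ) : Fin.tail (win u (k + 1) t) = win u k (t + 1) := by
  funext i
  simp only [Fin.tail, win, Fin.val_succ]
  congr 1
  omega

lemma init_win (u : ℕ → Ω) (k t : ℕ) : Fin.init (win u (k + 1) t) = win u k t := rfl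

variable [Fintype Ω]

/-- `u` repeats a cyclic de Bruijn word of order `m`: it has period `b ^ m`, and its windows of
length `m` determine the index modulo the period. -/
structure IsPeriodicDeBruijn (m : ℕ) (u : ℕ → Ω) : Prop where
  periodic : Function.Periodic u (Fintype.card Ω ^ m)
  inj : ∀ s t, win u m s = win u m t → s ≡ t [MOD Fintype.card Ω ^ m]

/-- Removing the edges of a closed trail without repeated vertices leaves the edges with a given
middle part connected through common end vertices: from the complete bipartite graph `K_{b,b}`,
at most one edge at each vertex is removed if `b ≥ 3`, and at most one edge altogether if `b = 2`.
Here `R` consists of the remaining edges. -/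
lemma edge_connected {n : ℕ} {s : Fin n → Ω} {R : Set (Fin (n + 2) → Ω)}
    (hcol : ∀ x x' y, edge x s y ∉ R → edge x' s y ∉ R → x = x')
    (hsingle : 3 ≤ Fintype.card Ω ∨
      ∀ x x' y y', edge x s y ∉ R → edge x' s y' ∉ R → x = x')
    {O : Set (Fin (n + 2) → Ω)}
    (hinit : ∀ x y y', edge x s y ∈ R → edge x s y ∈ O → edge x s y' ∈ R → edge x s y' ∈ O)
    (htail : ∀ x x' y, edge x s y ∈ R → edge x s y ∈ O → edge x' s y ∈ R → edge x' s y ∈ O)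
    {x y x' y' : Ω} (he : edge x s y ∈ R) (heO : edge x s y ∈ O) (hf : edge x' s y' ∈ R) :
    edge x' s y' ∈ O := by
  classical
  by_cases h1 : edge x s y' ∈ R
  · exact htail x x' y' h1 (hinit x y y' he heO h1) hf
  by_cases h2 : edge x' s y ∈ R
  · exact hinit x' y y' h2 (htail x x' y he heO h2) hf
  have hne : x ≠ x' := by rintro rfl; exact h1 hf
  rcases hsingle with h3 | h3
  · obtain ⟨x'', hx''⟩ : ∃ x'', x'' ∉ ({x, x'} : Finset Ω) := by
      by_contra hcon
      push Not at hcon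
      have h4 : Fintype.card Ω ≤ ({x, x'} : Finset Ω).card := by
        rw [← Finset.card_univ]; exact Finset.card_le_card fun z _ => hcon z
      have := h4.trans Finset.card_le_two
      omega
    simp only [Finset.mem_insert, Finset.mem_singleton, not_or] at hx''
    have h5 : edge x'' s y ∈ R := by
      by_contra h; exact hx''.2 (hcol _ _ _ h h2)
    have h6 : edge x'' s y' ∈ R := by
      by_contra h; exact hx''.1 (hcol _ _ _ h h1)
    exact htail x'' x' y' h6 (hinit x'' y y' h5 (htail x x'' y he heO h5) h6) hf
  · exact absurd (h3 _ _ _ _ h1 h2) hne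

/-- Let `u` have period `N` and pass, in one period, through distinct words of length `n + 1`; if
there are only two symbols, let even its windows of length `n` be distinct. Then the first `N`
symbols of `u` extend to a de Bruijn word of order `n + 2`: in the de Bruijn graph with edges the
words of length `n + 2`, the closed trail of `u` extends to one through all edges. -/
theorem exists_extension (hΩ : 2 ≤ Fintype.card Ω) {n N : ℕ} (hN : 0 < N) {u : ℕ → Ω}
    (hper : Function.Periodic u N)
    (hinj : ∀ s t, win u (n + 1) s = win u (n + 1) t → s ≡ t [MOD N])
    (hcard : 3 ≤ Fintype.card Ω ∨ ∀ s t, win u n s = win u n t → s ≡ t [MOD N]) :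
    ∃ u' : ℕ → Ω, IsPeriodicDeBruijn (n + 2) u' ∧ ∀ t < N, u' t = u t := by
  classical
  have hmod : ∀ s t, s ≡ t [MOD N] → u s = u t := by
    intro s t h
    rw [← hper.map_mod_nat s, ← hper.map_mod_nat t, h]
  have hwmod : ∀ k s t, s ≡ t [MOD N] → win u k s = win u k t := by
    intro k s t h
    funext i
    exact hmod _ _ (h.add_right _)
  have hex : ∃ x y : Ω, x ≠ y := Fintype.one_lt_card_iff.mp (by omega)
  have hother : ∀ a : Ω, ∃ y, y ≠ a := by
    intro a
    obtain ⟨x, y, hxy⟩ := hex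
    by_cases h : x = a
    · exact ⟨y, fun h' => hxy (h.trans h'.symm)⟩
    · exact ⟨x, h⟩
  let c : ℕ → Fin (n + 2) → Ω := fun t => win u (n + 2) t
  have hc_tail : ∀ t, Fin.tail (c t) = win u (n + 1) (t + 1) := tail_win u (n + 1)
  have hc_init : ∀ t, Fin.init (c t) = win u (n + 1) t := init_win u (n + 1)
  have hc_inj : ∀ s t, c s = c t → s ≡ t [MOD N] := fun s t h =>
    hinj s t (by rw [← hc_init, ← hc_init, h])
  -- the letters before and after a vertex of the trail
  have hletters : ∀ v : Fin (n + 1) → Ω, ∃ a : Ω × Ω, ∀ t, v = win u (n + 1) (t + 1) →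
      a.1 = u t ∧ a.2 = u (t + (n + 2)) := by
    intro v
    by_cases h : ∃ t, v = win u (n + 1) (t + 1)
    · obtain ⟨t, rfl⟩ := h
      refine ⟨(u t, u (t + (n + 2))), fun t' ht' => ?_⟩
      have h1 := Nat.ModEq.add_right_cancel' 1 (hinj _ _ ht')
      exact ⟨hmod _ _ h1, hmod _ _ (h1.add_right _)⟩
    · exact ⟨(hex.choose, hex.choose), fun t ht => absurd ⟨t, ht⟩ h⟩
  choose a ha using hletters
  -- rotation of words, corrected so that the trail of `u` is followed
  let g : (Fin (n + 2) → Ω) → Fin (n + 2) → Ω := fun e =>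
    (Fin.snoc (Fin.tail e) (Equiv.swap (a (Fin.tail e)).1 (a (Fin.tail e)).2 (e 0)) :
      Fin (n + 2) → Ω)
  have hg : Function.Injective g := by
    intro e f hef
    have h1 := congrArg (fun w : Fin (n + 2) → Ω => Fin.init w) hef
    have h2 := congrArg (fun w : Fin (n + 2) → Ω => w (Fin.last _)) hef
    simp only [g, Fin.init_snoc, Fin.snoc_last] at h1 h2
    rw [h1] at h2
    have h3 := (Equiv.swap _ _).injective h2
    rw [← Fin.cons_self_tail e, ← Fin.cons_self_tail f, h1, h3]
  let σ₀ : Equiv.Perm (Fin (n + 2) → Ω) :=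
    Equiv.ofBijective g (Finite.injective_iff_bijective.mp hg)
  have hσ₀ : ∀ e, Fin.init (σ₀ e) = Fin.tail e := by
    intro e
    change Fin.init (g e) = Fin.tail e
    simp only [g, Fin.init_snoc]
  have hσ₀c : ∀ t, σ₀ (c t) = c (t + 1) := by
    intro t
    change g (c t) = c (t + 1)
    obtain ⟨h1, h2⟩ := ha (Fin.tail (c t)) t (hc_tail t)
    have h0 : c t 0 = u t := rfl
    rw [← Fin.snoc_init_self (c (t + 1)), hc_init, ← hc_tail]
    simp only [g]
    congr 1
    rw [h1, h2, h0, Equiv.swap_apply_left]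
    simp only [c, win, Fin.val_last]
    congr 1
    omega
  -- `R` consists of the edges off the trail; the trail may be left at its last edge, which belongs
  -- to `M`
  let M : Set (Fin (n + 2) → Ω) := {e | ∀ t, t + 1 < N → e ≠ c t}
  let R : Set (Fin (n + 2) → Ω) := {e | ∀ t, e ≠ c t}
  have hRM : R ⊆ M := fun e he t _ => he t
  have hnotR : ∀ e, e ∉ R → ∃ t, e = c t := by
    intro e he
    simpa [R] using he
  have hconn : ∀ O : Set (Fin (n + 2) → Ω), c 0 ∈ O → (∀ e, σ₀ e ∈ O ↔ e ∈ O) →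
      (∀ e ∈ O, e ∈ M → ∀ f ∈ M, Fin.tail f = Fin.tail e → f ∈ O) → ∀ e, e ∈ O := by
    intro O h0 hO hOM
    have hcO : ∀ t, c t ∈ O := by
      intro t
      induction t with
      | zero => exact h0
      | succ t ih => rw [← hσ₀c]; exact (hO _).mpr ih
    -- preimages and images of the remaining edges are remaining edges
    have hRinv : ∀ e, σ₀ e ∈ R → e ∈ R := by
      intro e he t h
      exact he (t + 1) (by rw [h, hσ₀c])
    have hRim : ∀ e, e ∈ R → σ₀ e ∈ R := by
      intro e he t h
      have h1 : c t = σ₀ (c (t + N - 1)) := by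
        rw [hσ₀c, Nat.sub_add_cancel (by omega)]
        exact hwmod _ _ _ (by simp [Nat.ModEq])
      exact he _ (σ₀.injective (h.trans h1))
    have htail : ∀ e f, e ∈ R → e ∈ O → f ∈ R → Fin.tail f = Fin.tail e → f ∈ O :=
      fun e f he heO hf h => hOM e heO (hRM he) f (hRM hf) h
    have hinit : ∀ e f, e ∈ R → e ∈ O → f ∈ R → Fin.init f = Fin.init e → f ∈ O := by
      intro e f he heO hf h
      obtain ⟨e', rfl⟩ := σ₀.surjective e
      obtain ⟨f', rfl⟩ := σ₀.surjective f
      rw [hσ₀, hσ₀] at h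
      exact (hO f').mpr (htail e' f' (hRinv e' he) ((hO e').mp heO) (hRinv f' hf) h)
    have hcol : ∀ (s : Fin n → Ω) x x' y, edge x s y ∉ R → edge x' s y ∉ R → x = x' := by
      intro s x x' y h1 h2
      obtain ⟨t, ht⟩ := hnotR _ h1
      obtain ⟨t', ht'⟩ := hnotR _ h2
      have h3 : win u (n + 1) (t + 1) = win u (n + 1) (t' + 1) := by
        rw [← hc_tail, ← hc_tail, ← ht, ← ht', tail_edge, tail_edge]
      have h4 := hmod _ _ (Nat.ModEq.add_right_cancel' 1 (hinj _ _ h3))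
      have h5 := congrFun ht 0
      have h6 := congrFun ht' 0
      exact h5.trans (h4.trans h6.symm)
    have hsingle : ∀ s : Fin n → Ω, 3 ≤ Fintype.card Ω ∨
        ∀ x x' y y', edge x s y ∉ R → edge x' s y' ∉ R → x = x' := by
      intro s
      refine hcard.imp_right fun h x x' y y' h1 h2 => ?_
      obtain ⟨t, ht⟩ := hnotR _ h1
      obtain ⟨t', ht'⟩ := hnotR _ h2
      have hs : ∀ x y t, edge x s y = c t → win u n (t + 1) = s := by
        intro x y t ht
        rw [← tail_win, ← hc_init, ← ht, init_edge, Fin.tail_cons]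
      have h3 := h (t + 1) (t' + 1) ((hs x y t ht).trans (hs x' y' t' ht').symm)
      have h4 := hmod _ _ (Nat.ModEq.add_right_cancel' 1 h3)
      exact (congrFun ht 0).trans (h4.trans (congrFun ht' 0).symm)
    -- one remaining edge with middle part `s` in `O` brings all of them into `O`
    have hmiddle : ∀ e f, e ∈ R → e ∈ O → f ∈ R →
        Fin.tail (Fin.init f) = Fin.tail (Fin.init e) → f ∈ O := by
      intro e f he heO hf h
      rw [← edge_eq e] at he heO
      rw [← edge_eq f, h] at hf ⊢
      refine edge_connected (hcol _) (hsingle _) ?_ ?_ he heO hf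
      · intro x y y' h1 h2 h3
        exact hinit _ _ h1 h2 h3 (by rw [init_edge, init_edge])
      · intro x x' y h1 h2 h3
        exact htail _ _ h1 h2 h3 (by rw [tail_edge, tail_edge])
    obtain ⟨f, hfR, hfO⟩ : ∃ f, f ∈ R ∧ f ∈ O := by
      obtain ⟨y, hy⟩ := hother (u (N - 1))
      have hlastM : c (N - 1) ∈ M := by
        intro t ht h
        have h1 := hc_inj _ _ h
        rw [Nat.ModEq, Nat.mod_eq_of_lt (by omega), Nat.mod_eq_of_lt (by omega)] at h1
        omega
      have hfR : (Fin.cons y (Fin.tail (c (N - 1))) : Fin (n + 2) → Ω) ∈ R := by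
        intro t h
        have h1 := congrArg (fun w : Fin (n + 2) → Ω => Fin.tail w) h
        have h2 : y = u t := congrFun h 0
        simp only [Fin.tail_cons, hc_tail] at h1
        rw [h2] at hy
        exact hy (hmod _ _ (Nat.ModEq.add_right_cancel' 1 (hinj _ _ h1)).symm)
      exact ⟨_, hfR, hOM _ (hcO (N - 1)) hlastM _ (hRM hfR) (Fin.tail_cons _ _)⟩
    -- the middle parts that are reached are closed under appending a letter
    let G : (Fin n → Ω) → Prop := fun s => ∀ e, e ∈ R → Fin.tail (Fin.init e) = s → e ∈ O
    have hG : ∀ s y, G s → G (Fin.tail (Fin.snoc s y : Fin (n + 1) → Ω)) := by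
      intro s y hs e heR he
      obtain ⟨x, hx⟩ : ∃ x, edge x s y ∈ R := by
        obtain ⟨x, x', hxx'⟩ := hex
        by_contra hcon
        push Not at hcon
        exact hxx' (hcol s x x' y (hcon x) (hcon x'))
      have hxO : edge x s y ∈ O := hs _ hx (by rw [init_edge, Fin.tail_cons])
      refine hmiddle _ e (hRim _ hx) ((hO _).mpr hxO) heR ?_
      rw [he, hσ₀, tail_edge]
    have hreach : ∀ (s' : Fin n → Ω) (j : ℕ), j ≤ n →
        ∃ s, G s ∧ ∀ q i : Fin n, (q : ℕ) + j = i + n → s q = s' i := by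
      intro s' j
      induction j with
      | zero =>
        intro _
        refine ⟨Fin.tail (Fin.init f), fun e he h => hmiddle f e hfR hfO he h, fun q i h => ?_⟩
        have := q.isLt
        omega
      | succ j ih =>
        intro hj
        obtain ⟨s, hs, hss'⟩ := ih (by omega)
        refine ⟨_, hG s (s' ⟨j, hj⟩) hs, fun q i h => ?_⟩
        have hi := i.isLt
        have hq := q.isLt
        by_cases hqn : (q : ℕ) + 1 < n
        · have h1 : (Fin.succ q) = Fin.castSucc (⟨q + 1, hqn⟩ : Fin n) := rfl
          rw [Fin.tail, h1, Fin.snoc_castSucc]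
          exact hss' _ _ (by simp only; omega)
        · have h1 : Fin.succ q = Fin.last n := by
            apply Fin.ext; simp only [Fin.val_succ, Fin.val_last]; omega
          rw [Fin.tail, h1, Fin.snoc_last]
          congr 1
          apply Fin.ext
          simp only
          omega
    intro e
    by_cases he : e ∈ R
    · obtain ⟨s, hs, hss'⟩ := hreach (Fin.tail (Fin.init e)) n le_rfl
      exact hs e he (funext fun q => (hss' q q rfl).symm)
    · obtain ⟨t, rfl⟩ := hnotR e he
      exact hcO t
  obtain ⟨σ, hσM, hσ', hcyc⟩ := exists_single_cycle
    (fun e : Fin (n + 2) → Ω => Fin.tail e) σ₀ M (c 0) hconn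
  have hσ : ∀ e, Fin.init (σ e) = Fin.tail e := by
    intro e
    obtain ⟨e', h1, h2⟩ := hσ' e
    rw [h2, hσ₀, h1]
  have hcycOn : σ.IsCycleOn (Finset.univ : Finset (Fin (n + 2) → Ω)) := by
    refine ⟨by simp, fun x _ y _ => (hcyc x).symm.trans (hcyc y)⟩
  have hpow : ∀ s t : ℕ, (σ ^ s) (c 0) = (σ ^ t) (c 0) ↔
      s ≡ t [MOD Fintype.card Ω ^ (n + 2)] := by
    intro s t
    have := hcycOn.pow_apply_eq_pow_apply (Finset.mem_univ (c 0)) (m := s) (n := t)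
    rwa [Finset.card_univ, Fintype.card_fun, Fintype.card_fin] at this
  have hshift : ∀ (j : ℕ) (e : Fin (n + 2) → Ω) (h : j < n + 2), ((σ ^ j) e) 0 = e ⟨j, h⟩ := by
    intro j
    induction j with
    | zero => intro e h; rfl
    | succ j ih =>
      intro e h
      rw [pow_succ, Equiv.Perm.mul_apply, ih (σ e) (by omega)]
      exact congrFun (hσ e) ⟨j, by omega⟩
  have hwin : ∀ t, win (fun t => ((σ ^ t) (c 0)) 0) (n + 2) t = (σ ^ t) (c 0) := by
    intro t
    funext i
    simp only [win]
    rw [Nat.add_comm t i, pow_add, Equiv.Perm.mul_apply, hshift _ _ i.isLt]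
  refine ⟨fun t => ((σ ^ t) (c 0)) 0, ⟨fun t => ?_, fun s t h => ?_⟩, fun t ht => ?_⟩
  · rw [(hpow (t + Fintype.card Ω ^ (n + 2)) t).mpr (by simp [Nat.ModEq])]
  · rw [hwin, hwin] at h
    exact (hpow s t).mp h
  · have : ∀ t, t < N → (σ ^ t) (c 0) = c t := by
      intro t
      induction t with
      | zero => intro _; rfl
      | succ t ih =>
        intro h
        rw [pow_succ', Equiv.Perm.mul_apply, ih (by omega), hσM, hσ₀c]
        intro hM
        exact hM t h rfl
    simp only
    rw [this t ht]
    rfl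

end Extension

/-! ### Infinite de Bruijn sequences -/

section InfiniteDeBruijn

variable {Ω : Type*} [Fintype Ω]

lemma IsPeriodicDeBruijn.isCyclicDeBruijn {m : ℕ} (hΩ : 2 ≤ Fintype.card Ω) {u : ℕ → Ω}
    (hu : IsPeriodicDeBruijn m u) : IsCyclicDeBruijn m (initial u (Fintype.card Ω ^ m)) := by
  set P := Fintype.card Ω ^ m with hP
  have hmP : m < P := Nat.lt_pow_self (by omega)
  have hrot : ∀ i, ((initial u P).rotate i).take m = List.ofFn (win u m i) := by
    intro i
    apply List.ext_getElem
    · simp only [List.length_take, List.length_rotate, length_initial, List.length_ofFn]; omega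
    · intro j h1 h2
      rw [List.getElem_take, List.getElem_rotate]
      refine (getElem_segment u 0 P _ _).trans ?_
      rw [length_initial, zero_add, hu.periodic.map_mod_nat, List.getElem_ofFn, win, add_comm]
  refine ⟨length_initial u P, fun v hv => ?_⟩
  rw [length_initial]
  have hinj : Function.Injective fun i : Fin P => win u m i := by
    intro i j h
    have := hu.inj _ _ h
    rw [← hP, Nat.ModEq, Nat.mod_eq_of_lt i.isLt, Nat.mod_eq_of_lt j.isLt] at this
    exact Fin.ext this
  have hbij := (Fintype.bijective_iff_injective_and_card _).mpr ⟨hinj, by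
    rw [Fintype.card_fin, Fintype.card_fun, Fintype.card_fin]⟩
  subst hv
  obtain ⟨i, hi⟩ := hbij.surjective v.get
  refine ⟨i, ⟨i.isLt, ?_⟩, fun j ⟨hj, hj'⟩ => ?_⟩
  · rw [hrot]
    simp only at hi
    rw [hi, List.ofFn_get]
  · rw [hrot] at hj'
    have h1 : win u v.length j = win u v.length i := by
      rw [← List.ofFn_inj, hj']
      simp only at hi
      rw [hi, List.ofFn_get]
    have := hinj (a₁ := ⟨j, hj⟩) (a₂ := i) h1
    exact congrArg Fin.val this

/-- The orders of consecutive de Bruijn words differ by one, and by two with two symbols. -/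
def orderStep (b : ℕ) : ℕ := if 3 ≤ b then 1 else 2

lemma IsPeriodicDeBruijn.exists_extension (hΩ : 2 ≤ Fintype.card Ω) {m : ℕ} (hm : 1 ≤ m)
    {u : ℕ → Ω} (hu : IsPeriodicDeBruijn m u) :
    ∃ u' : ℕ → Ω, IsPeriodicDeBruijn (m + orderStep (Fintype.card Ω)) u' ∧
      ∀ t < Fintype.card Ω ^ m, u' t = u t := by
  have hpos : 0 < Fintype.card Ω ^ m := Nat.pow_pos (by omega)
  unfold orderStep
  split_ifs with h3
  · obtain ⟨n, rfl⟩ : ∃ n, m = n + 1 := ⟨m - 1, by omega⟩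
    exact PoissonGen.exists_extension hΩ hpos hu.periodic hu.inj (Or.inl h3)
  · refine PoissonGen.exists_extension hΩ hpos hu.periodic (fun s t h => hu.inj s t ?_)
      (Or.inr hu.inj)
    exact congrArg (fun w : Fin (m + 1) → Ω => Fin.init w) h

lemma exists_isPeriodicDeBruijn_one (hΩ : 2 ≤ Fintype.card Ω) :
    ∃ u : ℕ → Ω, IsPeriodicDeBruijn 1 u := by
  have hpos : 0 < Fintype.card Ω := by omega
  refine ⟨fun t => (Fintype.equivFin Ω).symm ⟨t % Fintype.card Ω, Nat.mod_lt _ hpos⟩,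
    fun t => ?_, fun s t h => ?_⟩
  · simp
  · have := congrFun h 0
    simp only [win, Fin.val_zero, add_zero, EmbeddingLike.apply_eq_iff_eq, Fin.mk.injEq] at this
    rwa [pow_one]

/-- Infinite de Bruijn sequences exist, as each de Bruijn word extends to one of order greater by
one, or by two with two symbols. -/
theorem exists_isInfiniteDeBruijn (hΩ : 2 ≤ Fintype.card Ω) :
    ∃ A : ℕ → Ω, IsInfiniteDeBruijn A := by
  set b := Fintype.card Ω with hb
  set d := orderStep b with hd
  have hd1 : 1 ≤ d := by rw [hd]; unfold orderStep; split_ifs <;> omega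
  obtain ⟨u₀, hu₀⟩ := exists_isPeriodicDeBruijn_one hΩ
  have hstep : ∀ (j : ℕ) (u : {u : ℕ → Ω // IsPeriodicDeBruijn (1 + d * j) u}),
      ∃ u' : {u : ℕ → Ω // IsPeriodicDeBruijn (1 + d * (j + 1)) u},
        ∀ t < b ^ (1 + d * j), u'.1 t = u.1 t := by
    intro j u
    obtain ⟨u', h1, h2⟩ := u.2.exists_extension hΩ (by omega)
    exact ⟨⟨u', by rw [mul_add, mul_one, ← add_assoc]; exact h1⟩, h2⟩
  choose next hnext using hstep
  let U : (j : ℕ) → {u : ℕ → Ω // IsPeriodicDeBruijn (1 + d * j) u} :=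
    fun j => Nat.rec ⟨u₀, hu₀⟩ next j
  have hU : ∀ j, ∀ t < b ^ (1 + d * j), (U (j + 1)).1 t = (U j).1 t := fun j => hnext j (U j)
  have hUle : ∀ i j, i ≤ j → ∀ t < b ^ (1 + d * i), (U j).1 t = (U i).1 t := by
    intro i j hij
    induction j, hij using Nat.le_induction with
    | base => intro t _; rfl
    | succ j hij ih =>
      intro t ht
      rw [hU j t (ht.trans_le (Nat.pow_le_pow_right (by omega) (by gcongr))), ih t ht]
  have hlt : ∀ t, t < b ^ (1 + d * t) := by
    intro t
    have h1 : t ≤ 1 + d * t := by nlinarith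
    exact lt_of_le_of_lt h1 (Nat.lt_pow_self (by omega))
  have hcyc : ∀ j, IsCyclicDeBruijn (1 + d * j)
      (initial (fun t => (U t).1 t) (b ^ (1 + d * j))) := by
    intro j
    have h1 : initial (fun t => (U t).1 t) (b ^ (1 + d * j))
        = initial (U j).1 (b ^ (1 + d * j)) := by
      unfold initial segment
      refine List.map_congr_left fun t ht => ?_
      rw [List.mem_range] at ht
      change (U (0 + t)).1 (0 + t) = (U j).1 (0 + t)
      rw [zero_add]
      rcases le_total t j with h | h
      · exact (hUle t j h t (hlt t)).symm
      · exact hUle j t h t ht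
    rw [h1]
    exact (U j).2.isCyclicDeBruijn hΩ
  refine ⟨fun t => (U t).1 t, fun h3 k hk => ?_, fun h2 k hk => ?_⟩
  · have h1 : d = 1 := by rw [hd, orderStep, if_pos h3]
    have := hcyc (k - 1)
    rwa [show 1 + d * (k - 1) = k by rw [h1]; omega] at this
  · have h1 : d = 2 := by rw [hd, orderStep, if_neg (by omega)]
    have := hcyc (k - 1)
    rw [show 1 + d * (k - 1) = 2 * k - 1 by rw [h1]; omega, hb, h2] at this
    exact this

end InfiniteDeBruijn

/-! ### The Poisson distribution and two-point distributions -/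

section Distributions

lemma hasSum_poisson (lam : ℝ) : HasSum (poisson lam) 1 := by
  have h : HasSum (fun i : ℕ => lam ^ i / (Nat.factorial i : ℝ)) (Real.exp lam) := by
    rw [Real.exp_eq_exp_ℝ]
    exact NormedSpace.expSeries_div_hasSum_exp lam
  have := h.mul_left (Real.exp (-lam))
  rwa [← Real.exp_add, neg_add_cancel, Real.exp_zero] at this

lemma hasSum_mean_poisson (lam : ℝ) : HasSum (fun i : ℕ => (i : ℝ) * poisson lam i) lam := by
  rw [← hasSum_nat_add_iff' 1]
  simp only [Finset.range_one, Finset.sum_singleton, Nat.cast_zero, zero_mul, sub_zero]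
  have h := (hasSum_poisson lam).mul_left lam
  rw [mul_one] at h
  refine h.congr_fun fun i => ?_
  unfold poisson
  rw [Nat.factorial_succ, pow_succ]
  push_cast
  field_simp

lemma poisson_pos {lam : ℝ} (hlam : 0 < lam) (i : ℕ) : 0 < poisson lam i := by
  unfold poisson; positivity

/-- The distribution with mean `lam` on the two points `0` and `n`. -/
noncomputable def twoPoint (lam : ℝ) (n i : ℕ) : ℝ :=
  if i = 0 then 1 - lam / n else if i = n then lam / n else 0

lemma isAdmissible_twoPoint (b : ℕ) {lam : ℝ} (hlam : 0 < lam) {n : ℕ} (hn : 2 * lam ≤ n) :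
    IsAdmissible b lam (twoPoint lam n) := by
  have hn0 : (0 : ℝ) < n := by linarith
  have hn1 : n ≠ 0 := by rintro rfl; simp at hn0
  have hhalf : lam / n ≤ 1 / 2 := by rw [div_le_iff₀ hn0]; linarith
  have hpos : 0 ≤ lam / n := by positivity
  refine ⟨fun i => ?_, ?_, ?_, fun _ => ?_⟩
  · unfold twoPoint; split_ifs <;> linarith
  · have h : HasSum (twoPoint lam n) (∑ i ∈ {0, n}, twoPoint lam n i) := by
      refine hasSum_sum_of_ne_finset_zero fun i hi => ?_
      simp only [Finset.mem_insert, Finset.mem_singleton, not_or] at hi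
      rw [twoPoint, if_neg hi.1, if_neg hi.2]
    rw [Finset.sum_pair hn1.symm] at h
    simpa [twoPoint, hn1] using h
  · have h := hasSum_single (f := fun i : ℕ => (i : ℝ) * twoPoint lam n i) n fun i hi => by
      rcases Nat.eq_zero_or_pos i with rfl | h0
      · simp
      · rw [twoPoint, if_neg h0.ne', if_neg hi, mul_zero]
    simp only [twoPoint, if_neg hn1, if_true, mul_div_cancel₀ lam hn0.ne'] at h
    exact h
  · rw [twoPoint, if_pos rfl]; linarith

lemma twoPoint_ne_poisson {lam : ℝ} (hlam : 0 < lam) (n : ℕ) :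
    twoPoint lam n ≠ poisson lam := by
  intro h
  have h1 := congrFun h (n + 1)
  rw [twoPoint, if_neg (by omega), if_neg (by omega)] at h1
  exact (poisson_pos hlam (n + 1)).ne h1

lemma eq_of_twoPoint_eq {lam : ℝ} (hlam : 0 < lam) {m n : ℕ} (hm : m ≠ 0)
    (h : twoPoint lam m = twoPoint lam n) : m = n := by
  by_contra hne
  have h1 := congrFun h m
  rw [twoPoint, if_neg hm, if_pos rfl, twoPoint, if_neg hm, if_neg hne] at h1
  have : 0 < lam / m := div_pos hlam (by exact_mod_cast Nat.pos_of_ne_zero hm)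
  exact this.ne' h1

end Distributions

end PoissonGen

theorem corollary2 {Ω : Type*} [Fintype Ω] [DecidableEq Ω] (hΩ : 2 ≤ Fintype.card Ω)
    (lam : ℝ) (hlam : 0 < lam) :
    (∀ x : ℕ → Ω, PoissonGen.IsPoissonGeneric lam x → PoissonGen.IsBorelNormal x) ∧
    (∃ x : ℕ → Ω, PoissonGen.IsBorelNormal x ∧ ¬ PoissonGen.IsPoissonGeneric lam x) ∧
    (∃ A : ℕ → Ω, PoissonGen.IsInfiniteDeBruijn A) ∧
    (∀ A : ℕ → Ω, PoissonGen.IsInfiniteDeBruijn A →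
      (∀ p : ℕ → ℝ, PoissonGen.IsAdmissible (Fintype.card Ω) lam p → p ≠ PoissonGen.poisson lam →
        (∃ x : ℕ → Ω, PoissonGen.IsOutput A p x) ∧
        ∀ x : ℕ → Ω, PoissonGen.IsOutput A p x →
          PoissonGen.IsBorelNormal x ∧ ¬ PoissonGen.IsPoissonGeneric lam x) ∧
      {x : ℕ → Ω | (∃ p : ℕ → ℝ, PoissonGen.IsAdmissible (Fintype.card Ω) lam p ∧
          p ≠ PoissonGen.poisson lam ∧ PoissonGen.IsOutput A p x) ∧
        PoissonGen.IsBorelNormal x ∧ ¬ PoissonGen.IsPoissonGeneric lam x}.Infinite) := by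
  have hout : ∀ A : ℕ → Ω, PoissonGen.IsInfiniteDeBruijn A → ∀ p : ℕ → ℝ,
      PoissonGen.IsAdmissible (Fintype.card Ω) lam p → p ≠ PoissonGen.poisson lam →
      ∀ x : ℕ → Ω, PoissonGen.IsOutput A p x →
        PoissonGen.IsBorelNormal x ∧ ¬ PoissonGen.IsPoissonGeneric lam x := by
    intro A hA p hp hne x hx
    have hlim := hx.tendsto_Z hΩ hlam hA hp
    exact ⟨PoissonGen.isBorelNormal_of_tendsto_Z hΩ hlam hp.hasSum_mean hlim,
      fun h => hne (funext fun i => tendsto_nhds_unique (hlim i) (h i))⟩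
  obtain ⟨n₀, hn₀⟩ := exists_nat_ge (2 * lam)
  have hadm : ∀ n : ℕ, PoissonGen.IsAdmissible (Fintype.card Ω) lam
      (PoissonGen.twoPoint lam (n₀ + n)) := by
    intro n
    refine PoissonGen.isAdmissible_twoPoint _ hlam (hn₀.trans ?_)
    push_cast
    linarith [Nat.cast_nonneg (α := ℝ) n]
  refine ⟨fun x hx => PoissonGen.isBorelNormal_of_tendsto_Z hΩ hlam
    (PoissonGen.hasSum_mean_poisson lam) hx, ?_, PoissonGen.exists_isInfiniteDeBruijn hΩ,
    fun A hA => ⟨fun p hp hne => ⟨hp.exists_isOutput hΩ A, hout A hA p hp hne⟩, ?_⟩⟩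
  · obtain ⟨A, hA⟩ := PoissonGen.exists_isInfiniteDeBruijn hΩ
    obtain ⟨x, hx⟩ := (hadm 0).exists_isOutput hΩ A
    exact ⟨x, hout A hA _ (hadm 0) (PoissonGen.twoPoint_ne_poisson hlam _) x hx⟩
  · choose X hX using fun n => (hadm n).exists_isOutput hΩ A
    have hne := fun n => PoissonGen.twoPoint_ne_poisson hlam (n₀ + n)
    -- the distribution can be recovered from the output as the limit of the proportions
    refine Set.infinite_of_injective_forall_mem (f := X) (fun m n hmn => ?_)
      fun n => ⟨⟨_, hadm n, hne n, hX n⟩, hout A hA _ (hadm n) (hne n) _ (hX n)⟩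
    have heq : PoissonGen.twoPoint lam (n₀ + m) = PoissonGen.twoPoint lam (n₀ + n) := by
      funext i
      refine tendsto_nhds_unique ((hX m).tendsto_Z hΩ hlam hA (hadm m) i) ?_
      rw [hmn]
      exact (hX n).tendsto_Z hΩ hlam hA (hadm n) i
    have hn₀' : n₀ ≠ 0 := by
      rintro rfl
      rw [Nat.cast_zero] at hn₀
      linarith
    have := PoissonGen.eq_of_twoPoint_eq hlam (by omega) heq
    omega
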